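/- Theorem (Existence for a More General Background). Write $H^1=H^1(\mathbb R)$ for the real Sobolev space of all $u\in L^2(\mathbb R)$ whose weak derivative $u'$ is in $L^2(\mathbb R)$, let $G(x,y)=\tfrac12(|x|+|y|-|x-y|)\ge 0$, and put $$\mathcal X_1=\Big\{u\in H^1:\int_{\mathbb R}|x|\,u(x)^2\,dx<\infty,\ \int_{\mathbb R}u^2=1\Big\},$$ $$\mathcal B_1=\Big\{u\in H^1:\iint_{\mathbb R^2} G(x,y)\,u(x)^2u(y)^2\,dx\,dy<\infty,\ \int_{\mathbb R}u^2=1\Big\}.$$ Let $\rho\in L^1(\mathbb R)$ be real-valued with $\rho<0$ almost everywhere, $\int_{\mathbb R}|x||\rho(x)|\,dx<\infty$ and $\int_{\mathbb R}\rho=-z$, where $z\ge 1$. Consider the energy $$E[u]=\int_{\mathbb R}|u'(x)|^2\,dx+\frac12\iint -|x-y|\,\big(u(x)^2+\rho(x)\big)\big(u(y)^2+\rho(y)\big)\,dx\,dy,$$ where the double integral is understood as the limit, as $R\to\infty$, of the integrals over $[-R,R]^2$. For every $u\in\mathcal X_1$ the double integral converges absolutely as a Lebesgue integral over $\mathbb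 R^2$, and $E[u]$ is given by this Lebesgue integral. Moreover: 1. If $z>1$, there is $u\in\mathcal X_1$ with $E[u]=\inf_{v\in\mathcal X_1}E[v]$. 2. If $z=1$, then for every $v\in\mathcal B_1$ the limit defining $E[v]$ exists and is finite, and, with $V_\rho(x)=-\frac12\int_{\mathbb R}|x-y|\rho(y)\,dy$, $$E[v]=\int_{\mathbb R}|v'|^2+\iint_{\mathbb R^2}\Big(V_\rho(x)+V_\rho(y)-\tfrac12|x-y|\Big)v(x)^2v(y)^2\,dx\,dy-\frac12\iint_{\mathbb R^2}|x-y|\rho(x)\rho(y)\,dx\,dy,$$ with an absolutely convergent first double integral; and there is $u\in\mathcal B_1$ with $E[u]=\inf_{v\in\mathcal B_1}E[v]$. In both cases the infimum is finite. -/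

import Mathlib

open MeasureTheory Filter Topology Set
open scoped ContDiff

namespace MaxwellSchrodinger

noncomputable section

/-- `g` is a weak (distributional) derivative of `u` on the real line. -/
def IsWeakDeriv (u g : ℝ → ℝ) : Prop :=
  LocallyIntegrable u ∧ LocallyIntegrable g ∧
    ∀ φ : ℝ → ℝ, ContDiff ℝ ∞ φ → HasCompactSupport φ →
      ∫ x, u x * deriv φ x = -∫ x, g x * φ x

open Classical in
/-- The weak derivative `u'` (unique up to null sets; `0` if there is none). -/
def weakDeriv (u : ℝ → ℝ) : ℝ → ℝ :=
  if h : ∃ g, IsWeakDeriv u g then Classical.choose h else 0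

/-- The Sobolev space `H¹(ℝ)`, real-valued: `u` and its weak derivative are in `L²`.
Its elements are functions; everything below depends only on their a.e. classes. -/
def H1 : Set (ℝ → ℝ) :=
  {u | MemLp u 2 ∧ ∃ g, IsWeakDeriv u g ∧ MemLp g 2}

/-- The space `𝓧` of all `u ∈ H¹` with `∫ |x| u(x)² dx < ∞`. -/
def X : Set (ℝ → ℝ) :=
  {u | u ∈ H1 ∧ Integrable (fun x => |x| * u x ^ 2)}

/-- The kernel `G(x,y) = (|x| + |y| - |x - y|) / 2`. It equals `min {|x|, |y|}` if `xy > 0`,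
and `0` otherwise. -/
def G (x y : ℝ) : ℝ := (|x| + |y| - |x - y|) / 2

/-- The space `𝓑` of all `u ∈ H¹` with `∬ G(x,y) u(x)² u(y)² dx dy < ∞`. -/
def B : Set (ℝ → ℝ) :=
  {u | u ∈ H1 ∧ Integrable (fun p : ℝ × ℝ => G p.1 p.2 * u p.1 ^ 2 * u p.2 ^ 2)}

/-- `A₁`: the elements of `A` of unit `L²` norm. -/
def unitMass (A : Set (ℝ → ℝ)) : Set (ℝ → ℝ) :=
  {u | u ∈ A ∧ ∫ x, u x ^ 2 = 1}

/-- The Coulomb integrand `-|x - y| (u(x)² + ρ(x)) (u(y)² + ρ(y))`. -/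
def coulombIntegrand (ρ u : ℝ → ℝ) (p : ℝ × ℝ) : ℝ :=
  -|p.1 - p.2| * (u p.1 ^ 2 + ρ p.1) * (u p.2 ^ 2 + ρ p.2)

/-- The Coulomb energy of the charge contained in `[-R, R]`. -/
def coulombTrunc (ρ u : ℝ → ℝ) (R : ℝ) : ℝ :=
  1 / 2 * ∫ p in Icc (-R) R ×ˢ Icc (-R) R, coulombIntegrand ρ u p

/-- The energy
`E[u] = ∫ |u'|² dx + 1/2 ∬ -|x - y| (u(x)² + ρ(x)) (u(y)² + ρ(y)) dx dy`.
The double integral is the limit as `R → ∞` of the integrals over `[-R, R]²`. It agrees with the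
Lebesgue integral over the plane if the integrand is integrable, as it is for `u ∈ 𝓧`; for
`u ∈ 𝓑` of infinite first moment the integrand is not integrable. -/
def energy (ρ u : ℝ → ℝ) : ℝ :=
  (∫ x, weakDeriv u x ^ 2) + limUnder atTop (coulombTrunc ρ u)

/-- The potential of the background, `V_ρ(x) = -1/2 ∫ |x - y| ρ(y) dy`. -/
def potential (ρ : ℝ → ℝ) (x : ℝ) : ℝ :=
  -(1 / 2) * ∫ y, |x - y| * ρ y

/-- `(V_ρ(x) + V_ρ(y) - |x - y| / 2) u(x)² u(y)²`. -/
def reducedIntegrand (ρ u : ℝ → ℝ) (p : ℝ × ℝ) : ℝ :=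
  (potential ρ p.1 + potential ρ p.2 - 1 / 2 * |p.1 - p.2|) * u p.1 ^ 2 * u p.2 ^ 2

/-- The Coulomb energy rewritten with the help of `∫ u² = 1`:
`∬ (V_ρ(x) + V_ρ(y) - |x - y| / 2) u(x)² u(y)² dx dy - 1/2 ∬ |x - y| ρ(x) ρ(y) dx dy`. -/
def reducedCoulomb (ρ u : ℝ → ℝ) : ℝ :=
  (∫ p, reducedIntegrand ρ u p) + 1 / 2 * ∫ p : ℝ × ℝ, -|p.1 - p.2| * ρ p.1 * ρ p.2

end

end MaxwellSchrodinger

/-!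
Write `f = u²`, so that `∫ f = 1`, and let `m = ∫ |x| |ρ|`. Since `ρ` has one sign, its potential
satisfies `(z |x| - m) / 2 ≤ V_ρ(x) ≤ (z |x| + m) / 2`. Hence the kernel
`V_ρ(x) + V_ρ(y) - |x - y| / 2 + m` (`shiftedKernel`) lies between
`(z - 1) (|x| + |y|) / 2 + G(x, y)` and the same expression plus `2 m`. In particular it dominates
`G ≥ 0`, and the functions of unit mass for which its interaction converges (`admissible`) are
exactly `𝓧₁` if `z > 1` and exactly `𝓑₁` if `z = 1`. Both cases of the theorem are therefore one
minimization problem.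

*The energy in terms of the kernel* (`IsBackground.tendsto_coulombTrunc`). On `[-R, R]²` the
Coulomb energy differs from the reduced one by a contribution of the background outside
`[-R, R]`, which vanishes in the limit, and by at most a constant times `ε_R (1 + M_R)`, where
`ε_R = ∫_{|x| > R} f` is the missing mass and `M_R = ∫_{|x| ≤ R} |x| f`. On each half-line `G` is
the minimum of `|x|` and `|y|`. So `R ε_R²` is controlled, up to a factor, by the tails of the
convergent integral `∬ G f f` and tends to `0`; and because `|x| |y| ≤ R min(|x|, |y|)` for
`|x|, |y| ≤ R`, `M_R²` is at most of order `R`. The product `ε_R M_R` tends to `0`, even when the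
first moment of `f` is infinite.

*Existence of a minimizer* (`exists_minimizer`), for any kernel that dominates `G`. An `H¹` function
on the line is a.e. equal to `a + ∫₀ˣ g` with `g ∈ L²` its weak derivative
(`IsWeakDeriv.exists_ae_eq_primitive`). Along a minimizing sequence the `g` are bounded in `L²` and
the `a` are bounded, so after passing to a subsequence the `g` converge weakly, the `a` converge,
and the functions converge at every point. The kinetic energy is weakly lower semicontinuous, the
nonnegative interaction passes to the limit by Fatou's lemma, and `∬ G f f ≤ C` leaves a mass of at
most `2 √(C / R)` outside `[-R, R]`, so the limit still has unit mass.
-/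

namespace MaxwellSchrodinger

/-! ### Weak derivatives on the line -/

theorem IsWeakDeriv.ae_unique {u g g' : ℝ → ℝ} (h : IsWeakDeriv u g) (h' : IsWeakDeriv u g') :
    g =ᵐ[volume] g' := by
  refine ae_eq_of_integral_contDiff_smul_eq h.2.1 h'.2.1 fun φ hφ hc => ?_
  have h1 := h.2.2 φ hφ hc
  rw [h'.2.2 φ hφ hc, neg_inj] at h1
  simpa only [smul_eq_mul, mul_comm] using h1.symm

theorem IsWeakDeriv.weakDeriv_ae_eq {u g : ℝ → ℝ} (h : IsWeakDeriv u g) :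
    weakDeriv u =ᵐ[volume] g := by
  have hex : ∃ g, IsWeakDeriv u g := ⟨g, h⟩
  rw [weakDeriv, dif_pos hex]
  exact (Classical.choose_spec hex).ae_unique h

theorem intervalIntegrable_of_locallyIntegrable {g : ℝ → ℝ} (hg : LocallyIntegrable g) (a b : ℝ) :
    IntervalIntegrable g volume a b :=
  intervalIntegrable_iff.mpr <|
    (hg.integrableOn_isCompact isCompact_uIcc).mono_set uIoc_subset_uIcc

theorem exists_support_subset_Ioo {φ : ℝ → ℝ} (hc : HasCompactSupport φ) :
    ∃ R : ℝ, 0 < R ∧ tsupport φ ⊆ Ioo (-R) R := by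
  obtain ⟨R, hR0, hR⟩ := hc.isCompact.isBounded.subset_ball_lt 0 0
  refine ⟨R, hR0, fun x hx => ?_⟩
  simpa [abs_lt] using hR hx

/-- The absolutely continuous function with value `a` at the origin and derivative `g`. -/
noncomputable def primitive (a : ℝ) (g : ℝ → ℝ) (x : ℝ) : ℝ := a + ∫ t in (0 : ℝ)..x, g t

theorem continuous_primitive {g : ℝ → ℝ} (hg : LocallyIntegrable g) (a : ℝ) :
    Continuous (primitive a g) :=
  continuous_const.add <| intervalIntegral.continuous_primitive
    (intervalIntegrable_of_locallyIntegrable hg) 0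

theorem isWeakDeriv_primitive {g : ℝ → ℝ} (hg : LocallyIntegrable g) (a : ℝ) :
    IsWeakDeriv (primitive a g) g := by
  refine ⟨(continuous_primitive hg a).locallyIntegrable, hg, fun φ hφ hc => ?_⟩
  obtain ⟨R, hR0, hR⟩ := exists_support_subset_Ioo hc
  have hφR : φ R = 0 := image_eq_zero_of_notMem_tsupport fun h => lt_irrefl _ (hR h).2
  have hφR' : φ (-R) = 0 := image_eq_zero_of_notMem_tsupport fun h => lt_irrefl _ (hR h).1
  have hs1 : Function.support (fun x => primitive a g x * deriv φ x) ⊆ Ioc (-R) R := by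
    intro x hx
    have hx' : x ∈ Function.support (deriv φ) := fun h => hx (by simp [h])
    exact Ioo_subset_Ioc_self (hR (support_deriv_subset hx'))
  have hs2 : Function.support (fun x => g x * φ x) ⊆ Ioc (-R) R := by
    intro x hx
    have hx' : x ∈ Function.support φ := fun h => hx (by simp [h])
    exact Ioo_subset_Ioc_self (hR (subset_tsupport _ hx'))
  rw [← intervalIntegral.integral_eq_integral_of_support_subset hs1,
    ← intervalIntegral.integral_eq_integral_of_support_subset hs2]
  have hac1 : AbsolutelyContinuousOnInterval (primitive a g) (-R) R :=
    ((contDiff_const (c := a)).contDiffOn.absolutelyContinuousOnInterval).add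
      ((intervalIntegrable_of_locallyIntegrable hg _ _).absolutelyContinuousOnInterval_intervalIntegral
        (by rw [mem_uIcc]; left; constructor <;> linarith))
  have hac2 : AbsolutelyContinuousOnInterval φ (-R) R :=
    ((hφ.of_le (by simp)).contDiffOn).absolutelyContinuousOnInterval
  rw [hac1.integral_mul_deriv_eq_deriv_mul hac2, hφR, hφR', mul_zero, mul_zero, sub_zero, zero_sub]
  congr 1
  refine intervalIntegral.integral_congr_ae ?_
  filter_upwards [_root_.LocallyIntegrable.ae_hasDerivAt_integral hg] with x hx _
  rw [((hx 0).const_add a).deriv.symm]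
  rfl

/-- A test function with vanishing integral is the derivative of a test function. -/
theorem exists_hasCompactSupport_deriv_eq {η : ℝ → ℝ} (hη : ContDiff ℝ ∞ η)
    (hc : HasCompactSupport η) (h0 : ∫ x, η x = 0) :
    ∃ φ : ℝ → ℝ, ContDiff ℝ ∞ φ ∧ HasCompactSupport φ ∧ deriv φ = η := by
  obtain ⟨R, hR0, hR⟩ := exists_support_subset_Ioo hc
  have hsupp : ∀ x, x ∉ Ioo (-R) R → η x = 0 := fun x hx =>
    image_eq_zero_of_notMem_tsupport fun h => hx (hR h)
  have hder : ∀ x, HasDerivAt (fun x => ∫ t in (-R)..x, η t) (η x) x := fun x =>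
    hη.continuous.integral_hasStrictDerivAt (-R) x |>.hasDerivAt
  have hderiv : deriv (fun x => ∫ t in (-R)..x, η t) = η := funext fun x => (hder x).deriv
  refine ⟨fun x => ∫ t in (-R)..x, η t, ?_, ?_, hderiv⟩
  · rw [contDiff_infty_iff_deriv, hderiv]
    exact ⟨fun x => (hder x).differentiableAt, hη⟩
  · refine HasCompactSupport.intro (isCompact_Icc (a := -R) (b := R)) fun x hx => ?_
    rw [mem_Icc, not_and_or, not_le, not_le] at hx
    rcases hx with hx | hx
    · rw [intervalIntegral.integral_congr (g := fun _ => 0), intervalIntegral.integral_zero]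
      intro t ht
      rw [uIcc_of_ge hx.le] at ht
      exact hsupp t fun h => absurd h.1 (not_lt.2 ht.2)
    · rw [intervalIntegral.integral_eq_integral_of_support_subset, h0]
      intro t ht
      have : t ∈ Ioo (-R) R := by
        by_contra h
        exact ht (hsupp t h)
      exact ⟨this.1, (this.2.trans hx).le⟩

theorem integrable_mul_test {w φ : ℝ → ℝ} (hw : LocallyIntegrable w)
    (hφ : ContDiff ℝ ∞ φ) (hc : HasCompactSupport φ) : Integrable fun x => w x * φ x := by
  simpa only [smul_eq_mul, mul_comm] using
    hw.integrable_smul_left_of_hasCompactSupport hφ.continuous hc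

/-- Du Bois-Reymond: a distribution on the line with derivative zero is a constant. -/
theorem exists_ae_eq_const_of_integral_mul_deriv_eq_zero {w : ℝ → ℝ} (hw : LocallyIntegrable w)
    (h : ∀ φ : ℝ → ℝ, ContDiff ℝ ∞ φ → HasCompactSupport φ → ∫ x, w x * deriv φ x = 0) :
    ∃ c : ℝ, w =ᵐ[volume] fun _ => c := by
  let ψ₀ : ℝ → ℝ := (default : ContDiffBump (0 : ℝ)).normed volume
  have hψ₀ : ContDiff ℝ ∞ ψ₀ := ContDiffBump.contDiff_normed _
  have hc₀ : HasCompactSupport ψ₀ := ContDiffBump.hasCompactSupport_normed _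
  have h1 : ∫ x, ψ₀ x = 1 := ContDiffBump.integral_normed _
  refine ⟨∫ x, w x * ψ₀ x, ?_⟩
  refine ae_eq_of_integral_contDiff_smul_eq hw
    (continuous_const.locallyIntegrable) fun ψ hψ hc => ?_
  have hψi : Integrable ψ := hψ.continuous.integrable_of_hasCompactSupport hc
  have hψ₀i : Integrable ψ₀ := hψ₀.continuous.integrable_of_hasCompactSupport hc₀
  obtain ⟨φ, hφ, hcφ, hd⟩ := exists_hasCompactSupport_deriv_eq
    (η := fun x => ψ x - (∫ y, ψ y) * ψ₀ x) (hψ.sub (contDiff_const.mul hψ₀))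
    (hc.sub (hc₀.mul_left)) (by
      rw [integral_sub hψi (hψ₀i.const_mul _), integral_const_mul, h1]; ring)
  have h2 := h φ hφ hcφ
  rw [hd] at h2
  have e : ∀ x, w x * (ψ x - (∫ y, ψ y) * ψ₀ x) = w x * ψ x - (∫ y, ψ y) * (w x * ψ₀ x) :=
    fun x => by ring
  simp only [e] at h2
  rw [integral_sub (integrable_mul_test hw hψ hc)
    ((integrable_mul_test hw hψ₀ hc₀).const_mul _), integral_const_mul,
    sub_eq_zero] at h2
  simp only [smul_eq_mul]
  rw [integral_mul_const, ← h2]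
  simp only [mul_comm]

theorem IsWeakDeriv.exists_ae_eq_primitive {u g : ℝ → ℝ} (h : IsWeakDeriv u g) :
    ∃ a : ℝ, u =ᵐ[volume] primitive a g := by
  have hp := isWeakDeriv_primitive h.2.1 0
  obtain ⟨c, hc⟩ := exists_ae_eq_const_of_integral_mul_deriv_eq_zero (h.1.sub hp.1)
    fun φ hφ hcφ => by
      have hφ' : ContDiff ℝ ∞ (deriv φ) := (contDiff_infty_iff_deriv.1 hφ).2
      simp only [Pi.sub_apply, sub_mul]
      rw [integral_sub (integrable_mul_test h.1 hφ' hcφ.deriv)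
        (integrable_mul_test hp.1 hφ' hcφ.deriv), h.2.2 φ hφ hcφ,
        hp.2.2 φ hφ hcφ, sub_self]
  refine ⟨c, ?_⟩
  filter_upwards [hc] with x hx
  simp only [Pi.sub_apply, primitive, zero_add] at hx
  rw [primitive, ← hx]
  ring

/-- A smooth function of compact support belongs to `H¹`. -/
theorem mem_H1_of_contDiff {φ : ℝ → ℝ} (hφ : ContDiff ℝ ∞ φ) (hc : HasCompactSupport φ) :
    φ ∈ H1 := by
  have hφ' : ContDiff ℝ ∞ (deriv φ) := (contDiff_infty_iff_deriv.1 hφ).2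
  refine ⟨hφ.continuous.memLp_of_hasCompactSupport hc, deriv φ,
    ⟨hφ.continuous.locallyIntegrable, hφ'.continuous.locallyIntegrable, fun ψ hψ hcψ => ?_⟩,
    hφ'.continuous.memLp_of_hasCompactSupport hc.deriv⟩
  have hψ' : ContDiff ℝ ∞ (deriv ψ) := (contDiff_infty_iff_deriv.1 hψ).2
  refine integral_mul_deriv_eq_deriv_mul_of_integrable
    (fun x _ => ((hφ.differentiable (by simp)) x).hasDerivAt)
    (fun x _ => ((hψ.differentiable (by simp)) x).hasDerivAt) ?_ ?_ ?_
  · exact (hφ.continuous.mul hψ'.continuous).integrable_of_hasCompactSupport hc.mul_right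
  · exact (hφ'.continuous.mul hψ.continuous).integrable_of_hasCompactSupport hcψ.mul_left
  · exact (hφ.continuous.mul hψ.continuous).integrable_of_hasCompactSupport hc.mul_right

/-! ### Weak compactness in `L²` -/

theorem integrable_mul_of_memLp_two {f g : ℝ → ℝ} (hf : MemLp f 2) (hg : MemLp g 2) :
    Integrable fun x => f x * g x :=
  MemLp.integrable_mul hf hg

/-- A bounded sequence in `L²` has a weakly convergent subsequence: the sequential Banach-Alaoglu
theorem for the separable space `L²`, identified with its dual. -/
theorem exists_subseq_tendsto_integral_mul {g : ℕ → ℝ → ℝ} {C : ℝ} (hg : ∀ n, MemLp (g n) 2)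
    (hC : ∀ n, ∫ x, g n x ^ 2 ≤ C) :
    ∃ (h : ℝ → ℝ) (φ : ℕ → ℕ), StrictMono φ ∧ MemLp h 2 ∧
      ∀ k : ℝ → ℝ, MemLp k 2 →
        Tendsto (fun n => ∫ x, k x * g (φ n) x) atTop (𝓝 (∫ x, k x * h x)) := by
  -- needed for the separability of `L²`
  have : Fact ((2 : ENNReal) ≠ ⊤) := ⟨by norm_num⟩
  let H := Lp ℝ 2 (volume : Measure ℝ)
  have hinner : ∀ {a b : ℝ → ℝ} (ha : MemLp a 2) (hb : MemLp b 2),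
      inner ℝ (ha.toLp a : H) (hb.toLp b : H) = ∫ x, b x * a x := by
    intro a b ha hb
    rw [L2.inner_def]
    refine integral_congr_ae ?_
    filter_upwards [ha.coeFn_toLp, hb.coeFn_toLp] with x hx hy
    rw [hx, hy]
    rfl
  let T : ℕ → WeakDual ℝ H := fun n =>
    StrongDual.toWeakDual (InnerProductSpace.toDual ℝ H ((hg n).toLp (g n)))
  have hT : ∀ n, T n ∈ WeakDual.toStrongDual ⁻¹' Metric.closedBall (0 : StrongDual ℝ H) √C := by
    intro n
    rw [mem_preimage, mem_closedBall_zero_iff]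
    change ‖InnerProductSpace.toDual ℝ H ((hg n).toLp (g n))‖ ≤ √C
    rw [LinearIsometryEquiv.norm_map]
    refine Real.le_sqrt_of_sq_le ?_
    rw [← real_inner_self_eq_norm_sq, hinner]
    simpa only [pow_two] using hC n
  obtain ⟨t, -, φ, hφ, ht⟩ := WeakDual.isSeqCompact_closedBall ℝ H 0 √C hT
  let h : H := (InnerProductSpace.toDual ℝ H).symm (WeakDual.toStrongDual t)
  have hh : MemLp (h : ℝ → ℝ) 2 := Lp.memLp h
  refine ⟨h, φ, hφ, hh, fun k hk => ?_⟩
  have h1 : Tendsto (fun n => T (φ n) (hk.toLp k : H)) atTop (𝓝 (t (hk.toLp k : H))) :=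
    ((WeakDual.eval_continuous (hk.toLp k : H)).tendsto t).comp ht
  have h2 : t (hk.toLp k : H) = ∫ x, k x * h x := by
    rw [← hinner hh hk, Lp.toLp_coeFn]
    exact (InnerProductSpace.toDual_symm_apply (𝕜 := ℝ) (x := (hk.toLp k : H))
      (y := WeakDual.toStrongDual t)).symm
  rw [h2] at h1
  refine h1.congr fun n => ?_
  rw [← hinner (hg (φ n)) hk]
  exact InnerProductSpace.toDual_apply_apply

/-- Weak lower semicontinuity of the `L²` norm, from `0 ≤ ∫ (h - gₙ)²`. -/
theorem integral_sq_le_of_tendsto {g : ℕ → ℝ → ℝ} {h : ℝ → ℝ} {k : ℝ} (hg : ∀ n, MemLp (g n) 2)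
    (hh : MemLp h 2)
    (hw : Tendsto (fun n => ∫ x, h x * g n x) atTop (𝓝 (∫ x, h x * h x)))
    (hk : Tendsto (fun n => ∫ x, g n x ^ 2) atTop (𝓝 k)) : ∫ x, h x ^ 2 ≤ k := by
  have h1 : ∀ n, 0 ≤ (∫ x, h x ^ 2) - 2 * (∫ x, h x * g n x) + ∫ x, g n x ^ 2 := by
    intro n
    have i1 := hh.integrable_sq
    have i2 := (integrable_mul_of_memLp_two hh (hg n)).const_mul 2
    have i3 := (hg n).integrable_sq
    have i12 : Integrable fun x => h x ^ 2 - 2 * (h x * g n x) := i1.sub i2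
    rw [← integral_const_mul, ← integral_sub i1 i2, ← integral_add i12 i3]
    refine integral_nonneg fun x => ?_
    have : 0 ≤ (h x - g n x) ^ 2 := sq_nonneg _
    simp only [Pi.zero_apply]
    linarith
  have h2 := ge_of_tendsto' ((tendsto_const_nhds.sub (hw.const_mul 2)).add hk) h1
  simp only [← pow_two] at h2
  linarith

/-- Fatou's lemma for Bochner integrals. -/
theorem integrable_and_integral_le_of_tendsto {α : Type*} [MeasurableSpace α] {μ : Measure α}
    {F : ℕ → α → ℝ} {f : α → ℝ} {L : ℝ} (hF : ∀ n, Integrable (F n) μ) (h0 : ∀ n x, 0 ≤ F n x)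
    (hlim : ∀ x, Tendsto (fun n => F n x) atTop (𝓝 (f x)))
    (hL : Tendsto (fun n => ∫ x, F n x ∂μ) atTop (𝓝 L)) :
    Integrable f μ ∧ ∫ x, f x ∂μ ≤ L := by
  have hf0 : ∀ x, 0 ≤ f x := fun x => ge_of_tendsto' (hlim x) fun n => h0 n x
  have hm : AEStronglyMeasurable f μ :=
    aestronglyMeasurable_of_tendsto_ae atTop (fun n => (hF n).1) (Eventually.of_forall hlim)
  have hL0 : 0 ≤ L := ge_of_tendsto' hL fun n => integral_nonneg (h0 n)
  have key : ∫⁻ x, ENNReal.ofReal (f x) ∂μ ≤ ENNReal.ofReal L := by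
    calc ∫⁻ x, ENNReal.ofReal (f x) ∂μ
        = ∫⁻ x, liminf (fun n => ENNReal.ofReal (F n x)) atTop ∂μ := by
          refine lintegral_congr fun x => ?_
          exact ((ENNReal.tendsto_ofReal (hlim x)).liminf_eq).symm
      _ ≤ liminf (fun n => ∫⁻ x, ENNReal.ofReal (F n x) ∂μ) atTop :=
          lintegral_liminf_le' fun n => (hF n).1.aemeasurable.ennreal_ofReal
      _ = ENNReal.ofReal L := by
          refine Tendsto.liminf_eq ?_
          refine (ENNReal.tendsto_ofReal hL).congr fun n => ?_
          exact ofReal_integral_eq_lintegral_ofReal (hF n) (Eventually.of_forall (h0 n))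
  have hi : Integrable f μ := by
    refine ⟨hm, ?_⟩
    rw [hasFiniteIntegral_iff_ofReal (Eventually.of_forall hf0)]
    exact key.trans_lt ENNReal.ofReal_lt_top
  refine ⟨hi, ?_⟩
  rw [← ofReal_integral_eq_lintegral_ofReal hi (Eventually.of_forall hf0)] at key
  exact (ENNReal.ofReal_le_ofReal_iff hL0).1 key

/-! ### Primitives of `L²` functions -/

theorem memLp_two_indicator_Ioc_one (a b : ℝ) :
    MemLp ((Ioc a b).indicator fun _ : ℝ => (1 : ℝ)) 2 :=
  memLp_indicator_const 2 measurableSet_Ioc 1 (Or.inr (by simp))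

theorem setIntegral_Ioc_eq_integral_indicator_mul (a b : ℝ) (g : ℝ → ℝ) :
    ∫ x in Ioc a b, g x = ∫ x, (Ioc a b).indicator (fun _ => (1 : ℝ)) x * g x := by
  rw [← integral_indicator measurableSet_Ioc]
  congr 1
  ext x
  by_cases hx : x ∈ Ioc a b <;> simp [hx]

/-- Weak convergence of the derivatives, tested against indicators of intervals, and convergence of
the values at the origin give pointwise convergence. -/
theorem tendsto_primitive {g : ℕ → ℝ → ℝ} {h : ℝ → ℝ} {a : ℕ → ℝ} {b : ℝ}
    (hw : ∀ k : ℝ → ℝ, MemLp k 2 →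
        Tendsto (fun n => ∫ x, k x * g n x) atTop (𝓝 (∫ x, k x * h x)))
    (ha : Tendsto a atTop (𝓝 b)) (x : ℝ) :
    Tendsto (fun n => primitive (a n) (g n) x) atTop (𝓝 (primitive b h x)) := by
  refine ha.add ?_
  simp only [intervalIntegral, setIntegral_Ioc_eq_integral_indicator_mul]
  exact (hw _ (memLp_two_indicator_Ioc_one _ _)).sub (hw _ (memLp_two_indicator_Ioc_one _ _))

theorem sq_setIntegral_Ioc_le {g : ℝ → ℝ} (hg : MemLp g 2) {a b : ℝ} (hab : a ≤ b) :
    (∫ x in Ioc a b, g x) ^ 2 ≤ (b - a) * ∫ x, g x ^ 2 := by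
  have i2 := hg.integrable_sq
  have i1 : IntegrableOn g (Ioc a b) :=
    ((hg.locallyIntegrable (by norm_num)).integrableOn_isCompact isCompact_Icc).mono_set
      Ioc_subset_Icc_self
  have h1 : ∫ x in Ioc a b, g x ^ 2 ≤ ∫ x, g x ^ 2 :=
    setIntegral_le_integral i2 (Eventually.of_forall fun x => sq_nonneg _)
  rcases hab.eq_or_lt with rfl | hlt
  · simp
  set m := ∫ x in Ioc a b, g x with hm
  -- Cauchy-Schwarz, as the variance of `g` over the interval is nonnegative
  have h2 : 0 ≤ ∫ x in Ioc a b, (g x - m / (b - a)) ^ 2 :=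
    integral_nonneg fun x => sq_nonneg _
  have e : ∀ x, (g x - m / (b - a)) ^ 2 =
      g x ^ 2 - 2 * (m / (b - a)) * g x + (m / (b - a)) ^ 2 := fun x => by ring
  simp only [e] at h2
  have i12 : IntegrableOn (fun x => g x ^ 2 - 2 * (m / (b - a)) * g x) (Ioc a b) :=
    i2.integrableOn.sub (i1.const_mul _)
  rw [integral_add i12 (by simp),
    integral_sub i2.integrableOn (i1.const_mul _), integral_const_mul, ← hm, setIntegral_const,
    Measure.real, Real.volume_Ioc, ENNReal.toReal_ofReal (by linarith), smul_eq_mul] at h2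
  have hpos : 0 < b - a := by linarith
  have h3 : 2 * (m / (b - a)) * m - (b - a) * (m / (b - a)) ^ 2 = m ^ 2 / (b - a) := by
    field_simp
    ring
  have h4 : m ^ 2 / (b - a) ≤ ∫ x, g x ^ 2 := by linarith
  rw [div_le_iff₀ hpos] at h4
  linarith

theorem sq_primitive_sub_le {g : ℝ → ℝ} (hg : MemLp g 2) (a x : ℝ) :
    (primitive a g x - a) ^ 2 ≤ |x| * ∫ t, g t ^ 2 := by
  rw [primitive, add_sub_cancel_left]
  rcases le_total 0 x with hx | hx
  · rw [intervalIntegral.integral_of_le hx, abs_of_nonneg hx]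
    simpa using sq_setIntegral_Ioc_le hg hx
  · rw [intervalIntegral.integral_of_ge hx, abs_of_nonpos hx, neg_sq]
    simpa using sq_setIntegral_Ioc_le hg hx

theorem sq_primitive_le {g : ℝ → ℝ} (hg : MemLp g 2) (a x : ℝ) :
    primitive a g x ^ 2 ≤ 2 * a ^ 2 + 2 * (|x| * ∫ t, g t ^ 2) := by
  nlinarith [sq_primitive_sub_le hg a x, sq_nonneg (primitive a g x - 2 * a)]

/-- The value at the origin is controlled by the `H¹` norm. -/
theorem sq_value_le_of_primitive {g : ℝ → ℝ} (hg : MemLp g 2) {a : ℝ}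
    (hv : MemLp (primitive a g) 2) :
    a ^ 2 ≤ 2 * (∫ x, primitive a g x ^ 2) + 2 * ∫ t, g t ^ 2 := by
  have hK : 0 ≤ ∫ t, g t ^ 2 := integral_nonneg fun _ => sq_nonneg _
  have i := hv.integrable_sq
  have h1 : ∫ x in Ioc (0 : ℝ) 1, primitive a g x ^ 2 ≤ ∫ x, primitive a g x ^ 2 :=
    setIntegral_le_integral i (Eventually.of_forall fun x => sq_nonneg _)
  have h2 : ∫ _ in Ioc (0 : ℝ) 1, (a ^ 2 / 2 - ∫ t, g t ^ 2) ≤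
      ∫ x in Ioc (0 : ℝ) 1, primitive a g x ^ 2 := by
    refine setIntegral_mono_on (by simp) i.integrableOn measurableSet_Ioc fun x hx => ?_
    have h3 := sq_primitive_sub_le hg a x
    rw [abs_of_pos hx.1] at h3
    nlinarith [mul_le_mul_of_nonneg_right hx.2 hK, sq_nonneg (2 * primitive a g x - a)]
  simp only [setIntegral_const, Measure.real, Real.volume_Ioc, smul_eq_mul] at h2
  norm_num at h2
  linarith

/-! ### The kernel `G` and tightness -/

theorem continuous_G : Continuous fun p : ℝ × ℝ => G p.1 p.2 := by
  unfold G
  fun_prop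

theorem G_nonneg (x y : ℝ) : 0 ≤ G x y := by
  have := abs_sub x y
  unfold G
  linarith

theorem G_le_abs_left (x y : ℝ) : G x y ≤ |x| := by
  have := abs_sub_abs_le_abs_sub y x
  rw [abs_sub_comm] at this
  unfold G
  linarith

theorem le_G_of_lt {R x y : ℝ} (hR : 0 ≤ R) (hx : R < x) (hy : R < y) : R ≤ G x y := by
  unfold G
  grind

theorem le_G_of_lt_neg {R x y : ℝ} (hR : 0 ≤ R) (hx : x < -R) (hy : y < -R) : R ≤ G x y := by
  unfold G
  grind

theorem integrable_prod_mul_self {f : ℝ → ℝ} (hf : Integrable f) :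
    Integrable fun p : ℝ × ℝ => f p.1 * f p.2 :=
  hf.mul_prod hf

theorem mul_sq_setIntegral_le {f : ℝ → ℝ} (h0 : ∀ x, 0 ≤ f x) (hf : Integrable f)
    (hG : Integrable fun p : ℝ × ℝ => G p.1 p.2 * f p.1 * f p.2) {S : Set ℝ}
    (hS : MeasurableSet S) {R : ℝ} (hR : ∀ x ∈ S, ∀ y ∈ S, R ≤ G x y) :
    R * (∫ x in S, f x) ^ 2 ≤ ∫ p in S ×ˢ S, G p.1 p.2 * f p.1 * f p.2 := by
  rw [pow_two, ← setIntegral_prod_mul, ← integral_const_mul]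
  refine setIntegral_mono_on ((integrable_prod_mul_self hf).const_mul R).integrableOn
    hG.integrableOn (hS.prod hS) fun p hp => ?_
  rw [mul_assoc]
  exact mul_le_mul_of_nonneg_right (hR _ hp.1 _ hp.2) (mul_nonneg (h0 _) (h0 _))

theorem integral_eq_add_tails {f : ℝ → ℝ} (hf : Integrable f) {R : ℝ} (hR : 0 ≤ R) :
    ∫ x, f x = (∫ x in Icc (-R) R, f x) + (∫ x in Ioi R, f x) + ∫ x in Iio (-R), f x := by
  have hd : Disjoint (Ioi R) (Iio (-R)) := by
    rw [Set.disjoint_left]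
    intro x hx hx'
    simp only [mem_Ioi, mem_Iio] at hx hx'
    linarith
  have hc : (Icc (-R) R)ᶜ = Ioi R ∪ Iio (-R) := by
    ext x
    simp only [mem_compl_iff, mem_Icc, not_and_or, not_le, mem_union, mem_Ioi, mem_Iio]
    exact or_comm
  rw [← integral_add_compl (measurableSet_Icc (a := -R) (b := R)) hf, hc,
    setIntegral_union hd measurableSet_Iio hf.integrableOn hf.integrableOn, add_assoc]

/-- A bound on `∬ G f f` leaves at most `2 √(C / R)` of the mass of `f` outside `[-R, R]`. -/
theorem integral_le_setIntegral_Icc_add {f : ℝ → ℝ} (h0 : ∀ x, 0 ≤ f x) (hf : Integrable f)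
    (hG : Integrable fun p : ℝ × ℝ => G p.1 p.2 * f p.1 * f p.2) {C : ℝ}
    (hC : ∫ p : ℝ × ℝ, G p.1 p.2 * f p.1 * f p.2 ≤ C) {R : ℝ} (hR : 0 < R) :
    ∫ x, f x ≤ (∫ x in Icc (-R) R, f x) + 2 * √(C / R) := by
  have key : ∀ S : Set ℝ, MeasurableSet S → (∀ x ∈ S, ∀ y ∈ S, R ≤ G x y) →
      ∫ x in S, f x ≤ √(C / R) := by
    intro S hS h
    refine Real.le_sqrt_of_sq_le ?_
    rw [le_div_iff₀ hR, mul_comm]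
    refine (mul_sq_setIntegral_le h0 hf hG hS h).trans (le_trans ?_ hC)
    exact setIntegral_le_integral hG (Eventually.of_forall fun p =>
      mul_nonneg (mul_nonneg (G_nonneg _ _) (h0 _)) (h0 _))
  have h1 := key (Ioi R) measurableSet_Ioi fun x hx y hy => le_G_of_lt hR.le hx hy
  have h2 := key (Iio (-R)) measurableSet_Iio fun x hx y hy => le_G_of_lt_neg hR.le hx hy
  rw [integral_eq_add_tails hf hR.le]
  linarith

theorem tendsto_two_mul_sqrt_div_atTop (C : ℝ) :
    Tendsto (fun R : ℝ => 2 * √(C / R)) atTop (𝓝 0) := by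
  have h : Tendsto (fun R : ℝ => C / R) atTop (𝓝 0) := tendsto_const_nhds.div_atTop tendsto_id
  simpa using (Real.continuous_sqrt.tendsto 0).comp h |>.const_mul 2

/-! ### Existence of minimizers -/

/-- The functions of unit mass in `H¹` for which the interaction with kernel `w` converges. -/
def admissible (w : ℝ × ℝ → ℝ) : Set (ℝ → ℝ) :=
  {u | (u ∈ H1 ∧ ∫ x, u x ^ 2 = 1) ∧ Integrable fun p : ℝ × ℝ => w p * u p.1 ^ 2 * u p.2 ^ 2}

/-- The sum of the kinetic energy and the interaction with kernel `w`. -/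
noncomputable def functional (w : ℝ × ℝ → ℝ) (u : ℝ → ℝ) : ℝ :=
  (∫ x, weakDeriv u x ^ 2) + ∫ p : ℝ × ℝ, w p * u p.1 ^ 2 * u p.2 ^ 2

theorem prod_ae_eq_of_ae_eq {u v : ℝ → ℝ} (h : u =ᵐ[volume] v) (w : ℝ × ℝ → ℝ) :
    (fun p : ℝ × ℝ => w p * u p.1 ^ 2 * u p.2 ^ 2) =ᵐ[volume]
      fun p => w p * v p.1 ^ 2 * v p.2 ^ 2 := by
  have h1 : ∀ᵐ p : ℝ × ℝ, u p.1 = v p.1 := Measure.quasiMeasurePreserving_fst.ae h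
  have h2 : ∀ᵐ p : ℝ × ℝ, u p.2 = v p.2 := Measure.quasiMeasurePreserving_snd.ae h
  filter_upwards [h1, h2] with p h1 h2
  rw [h1, h2]

theorem integrable_G_of_le {w : ℝ × ℝ → ℝ} (hw : ∀ p, G p.1 p.2 ≤ w p) {v : ℝ → ℝ}
    (hv : AEStronglyMeasurable v)
    (hi : Integrable fun p : ℝ × ℝ => w p * v p.1 ^ 2 * v p.2 ^ 2) :
    Integrable fun p : ℝ × ℝ => G p.1 p.2 * v p.1 ^ 2 * v p.2 ^ 2 := by
  refine hi.mono' ?_ (Eventually.of_forall fun p => ?_)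
  · exact (continuous_G.aestronglyMeasurable.mul ((hv.pow 2).comp_quasiMeasurePreserving
      Measure.quasiMeasurePreserving_fst)).mul ((hv.pow 2).comp_quasiMeasurePreserving
      Measure.quasiMeasurePreserving_snd)
  · rw [Real.norm_of_nonneg (mul_nonneg (mul_nonneg (G_nonneg _ _) (sq_nonneg _)) (sq_nonneg _))]
    exact mul_le_mul_of_nonneg_right
      (mul_le_mul_of_nonneg_right (hw p) (sq_nonneg _)) (sq_nonneg _)

/-- Compactness of minimizing sequences, for continuous representatives: the derivatives converge
weakly in `L²` and the values at the origin converge, so the functions converge pointwise; the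
interaction passes to the limit by Fatou's lemma, and the bound on `∬ G v² v²` keeps the mass from
escaping to infinity. -/
theorem exists_limit_primitive {w : ℝ × ℝ → ℝ} (hw : ∀ p, G p.1 p.2 ≤ w p)
    {g : ℕ → ℝ → ℝ} {a : ℕ → ℝ} (hg : ∀ n, MemLp (g n) 2)
    (hv : ∀ n, MemLp (primitive (a n) (g n)) 2)
    (hmass : ∀ n, ∫ x, primitive (a n) (g n) x ^ 2 = 1)
    (hi : ∀ n, Integrable fun p : ℝ × ℝ =>
      w p * primitive (a n) (g n) p.1 ^ 2 * primitive (a n) (g n) p.2 ^ 2)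
    {I : ℝ} (hI : Tendsto (fun n => (∫ x, g n x ^ 2) + ∫ p : ℝ × ℝ,
      w p * primitive (a n) (g n) p.1 ^ 2 * primitive (a n) (g n) p.2 ^ 2) atTop (𝓝 I)) :
    ∃ (h : ℝ → ℝ) (b : ℝ), MemLp h 2 ∧ MemLp (primitive b h) 2 ∧
      ∫ x, primitive b h x ^ 2 = 1 ∧
      (Integrable fun p : ℝ × ℝ => w p * primitive b h p.1 ^ 2 * primitive b h p.2 ^ 2) ∧
      (∫ x, h x ^ 2) + (∫ p : ℝ × ℝ, w p * primitive b h p.1 ^ 2 * primitive b h p.2 ^ 2) ≤ I := by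
  have hw0 : ∀ p, 0 ≤ w p := fun p => (G_nonneg _ _).trans (hw p)
  obtain ⟨C, hC⟩ := hI.bddAbove_range
  have hK0 : ∀ n, 0 ≤ ∫ x, g n x ^ 2 := fun n => integral_nonneg fun _ => sq_nonneg _
  have hD0 : ∀ n, 0 ≤ ∫ p : ℝ × ℝ,
      w p * primitive (a n) (g n) p.1 ^ 2 * primitive (a n) (g n) p.2 ^ 2 := fun n =>
    integral_nonneg fun p => mul_nonneg (mul_nonneg (hw0 p) (sq_nonneg _)) (sq_nonneg _)
  have hC' : ∀ n, (∫ x, g n x ^ 2) + ∫ p : ℝ × ℝ,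
      w p * primitive (a n) (g n) p.1 ^ 2 * primitive (a n) (g n) p.2 ^ 2 ≤ C := fun n =>
    hC (mem_range_self n)
  have hKC : ∀ n, ∫ x, g n x ^ 2 ≤ C := fun n => by linarith [hC' n, hD0 n]
  have hDC : ∀ n, ∫ p : ℝ × ℝ,
      w p * primitive (a n) (g n) p.1 ^ 2 * primitive (a n) (g n) p.2 ^ 2 ≤ C := fun n => by
    linarith [hC' n, hK0 n]
  have ha : ∀ n, a n ^ 2 ≤ 2 + 2 * C := fun n => by
    have := sq_value_le_of_primitive (hg n) (hv n)
    rw [hmass n] at this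
    linarith [hKC n]
  -- a subsequence along which derivatives, values at `0` and kinetic energies all converge
  obtain ⟨h, φ, hφ, hh, hweak⟩ := exists_subseq_tendsto_integral_mul hg hKC
  obtain ⟨b, -, ψ, hψ, hb⟩ :=
    (isCompact_Icc (a := -√(2 + 2 * C)) (b := √(2 + 2 * C))).tendsto_subseq
    (x := fun n => a (φ n)) fun n => abs_le.1 (Real.abs_le_sqrt (ha _))
  obtain ⟨k, -, θ, hθ, hk⟩ := (isCompact_Icc (a := (0 : ℝ)) (b := C)).tendsto_subseq
    (x := fun n => ∫ x, g (φ (ψ n)) x ^ 2) fun n => ⟨hK0 _, hKC _⟩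
  have hsub : Tendsto (fun n => φ (ψ (θ n))) atTop atTop :=
    hφ.tendsto_atTop.comp (hψ.tendsto_atTop.comp hθ.tendsto_atTop)
  let s : ℕ → ℕ := fun n => φ (ψ (θ n))
  let v : ℕ → ℝ → ℝ := fun n => primitive (a (s n)) (g (s n))
  have hweak' : ∀ k : ℝ → ℝ, MemLp k 2 →
      Tendsto (fun n => ∫ x, k x * g (s n) x) atTop (𝓝 (∫ x, k x * h x)) := fun k hk =>
    (hweak k hk).comp (hψ.tendsto_atTop.comp hθ.tendsto_atTop)
  have hlim : ∀ x, Tendsto (fun n => v n x) atTop (𝓝 (primitive b h x)) :=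
    tendsto_primitive hweak' (hb.comp hθ.tendsto_atTop)
  have hKlim : ∫ x, h x ^ 2 ≤ k :=
    integral_sq_le_of_tendsto (fun n => hg (s n)) hh (hweak' h hh) hk
  have hDlim : Tendsto (fun n => ∫ p : ℝ × ℝ, w p * v n p.1 ^ 2 * v n p.2 ^ 2) atTop
      (𝓝 (I - k)) := by
    refine ((hI.comp hsub).sub hk).congr fun n => ?_
    simp only [Function.comp_apply]
    exact add_sub_cancel_left _ _
  obtain ⟨hi1, hi2⟩ := integrable_and_integral_le_of_tendsto (fun n => hi (s n))
    (fun n p => mul_nonneg (mul_nonneg (hw0 p) (sq_nonneg _)) (sq_nonneg _))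
    (fun p => (((hlim p.1).pow 2).const_mul (w p)).mul ((hlim p.2).pow 2)) hDlim
  obtain ⟨hm1, hm2⟩ := integrable_and_integral_le_of_tendsto
    (fun n => (hv (s n)).integrable_sq) (fun n x => sq_nonneg _) (fun x => (hlim x).pow 2)
    (L := 1) (by simp only [hmass]; exact tendsto_const_nhds)
  have hcont : Continuous (primitive b h) :=
    continuous_primitive (hh.locallyIntegrable (by norm_num)) b
  refine ⟨h, b, hh, (memLp_two_iff_integrable_sq hcont.aestronglyMeasurable).2 hm1,
    le_antisymm hm2 ?_, hi1, by linarith⟩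
  have hC0 : 0 ≤ C := (hK0 0).trans (hKC 0)
  -- no mass is lost: compare on `[-R, R]`, then let `R → ∞`
  have hR : ∀ R : ℝ, 0 < R → 1 ≤ (∫ x, primitive b h x ^ 2) + 2 * √(C / R) := by
    intro R hR
    have hloc : Tendsto (fun n => ∫ x in Icc (-R) R, v n x ^ 2) atTop
        (𝓝 (∫ x in Icc (-R) R, primitive b h x ^ 2)) := by
      refine tendsto_integral_of_dominated_convergence
        (fun _ => 2 * (2 + 2 * C) + 2 * (R * C)) (fun n => ?_) (by simp) (fun n => ?_)
        (Eventually.of_forall fun x => (hlim x).pow 2)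
      · exact (hv (s n)).integrable_sq.1.restrict
      · filter_upwards [ae_restrict_mem measurableSet_Icc] with x hx
        rw [Real.norm_of_nonneg (sq_nonneg _)]
        have h1 := sq_primitive_le (hg (s n)) (a (s n)) x
        have h2 : |x| * ∫ t, g (s n) t ^ 2 ≤ R * C :=
          mul_le_mul (abs_le.2 hx) (hKC _) (hK0 _) hR.le
        linarith [ha (s n)]
    have h1 : ∀ n, 1 ≤ (∫ x in Icc (-R) R, v n x ^ 2) + 2 * √(C / R) := by
      intro n
      rw [← hmass (s n)]
      have hGi := integrable_G_of_le hw (hv (s n)).1 (hi (s n))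
      refine integral_le_setIntegral_Icc_add (fun x => sq_nonneg _) (hv (s n)).integrable_sq
        hGi ((integral_mono hGi (hi (s n)) fun p => ?_).trans (hDC (s n))) hR
      exact mul_le_mul_of_nonneg_right
        (mul_le_mul_of_nonneg_right (hw p) (sq_nonneg _)) (sq_nonneg _)
    have h2 := ge_of_tendsto' (hloc.add_const (2 * √(C / R))) h1
    have h3 : ∫ x in Icc (-R) R, primitive b h x ^ 2 ≤ ∫ x, primitive b h x ^ 2 :=
      setIntegral_le_integral hm1 (Eventually.of_forall fun x => sq_nonneg _)
    linarith
  have h4 := (tendsto_two_mul_sqrt_div_atTop C).const_add (∫ x, primitive b h x ^ 2)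
  rw [add_zero] at h4
  exact ge_of_tendsto h4 ((eventually_gt_atTop 0).mono fun R hR' => hR R hR')

/-- Every `u ∈ H¹` has an absolutely continuous representative whose derivative is in `L²`. -/
theorem exists_primitive_of_mem_H1 {u : ℝ → ℝ} (hu : u ∈ H1) :
    ∃ (a : ℝ) (g : ℝ → ℝ), MemLp g 2 ∧ weakDeriv u =ᵐ[volume] g ∧
      u =ᵐ[volume] primitive a g := by
  obtain ⟨-, g, hg, hg2⟩ := hu
  obtain ⟨a, ha⟩ := hg.exists_ae_eq_primitive
  exact ⟨a, g, hg2, hg.weakDeriv_ae_eq, ha⟩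

theorem exists_minimizer {w : ℝ × ℝ → ℝ} (hw : ∀ p, G p.1 p.2 ≤ w p)
    (hne : (admissible w).Nonempty) :
    ∃ u ∈ admissible w, ∀ v ∈ admissible w, functional w u ≤ functional w v := by
  have hw0 : ∀ p, 0 ≤ w p := fun p => (G_nonneg _ _).trans (hw p)
  have hbdd : BddBelow (functional w '' admissible w) := by
    refine ⟨0, ?_⟩
    rintro _ ⟨u, -, rfl⟩
    exact add_nonneg (integral_nonneg fun _ => sq_nonneg _)
      (integral_nonneg fun p => mul_nonneg (mul_nonneg (hw0 p) (sq_nonneg _)) (sq_nonneg _))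
  obtain ⟨J, -, hJ, hmem⟩ := exists_seq_tendsto_sInf (hne.image (functional w)) hbdd
  choose u hu huJ using hmem
  choose a g hg hug hua using fun n => exists_primitive_of_mem_H1 (hu n).1.1
  have hsq : ∀ n, (fun x => u n x ^ 2) =ᵐ[volume] fun x => primitive (a n) (g n) x ^ 2 := fun n => by
    filter_upwards [hua n] with x hx
    rw [hx]
  have hval : ∀ n, J n = (∫ x, g n x ^ 2) + ∫ p : ℝ × ℝ,
      w p * primitive (a n) (g n) p.1 ^ 2 * primitive (a n) (g n) p.2 ^ 2 := fun n => by
    rw [← huJ n, functional, integral_congr_ae (prod_ae_eq_of_ae_eq (hua n) w)]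
    congr 1
    refine integral_congr_ae ?_
    filter_upwards [hug n] with x hx
    rw [hx]
  obtain ⟨h, b, hh, hv, hm, hi, hle⟩ := exists_limit_primitive hw hg
    (fun n => (hu n).1.1.1.ae_eq (hua n))
    (fun n => by rw [← integral_congr_ae (hsq n)]; exact (hu n).1.2)
    (fun n => (hu n).2.congr (prod_ae_eq_of_ae_eq (hua n) w))
    (hJ.congr hval)
  have hwd := isWeakDeriv_primitive (hh.locallyIntegrable (by norm_num)) b
  refine ⟨primitive b h, ⟨⟨⟨hv, h, hwd, hh⟩, hm⟩, hi⟩, fun v hv => ?_⟩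
  refine le_trans ?_ (hle.trans (csInf_le hbdd (mem_image_of_mem _ hv)))
  refine (add_le_add_left (le_of_eq (integral_congr_ae ?_)) _)
  filter_upwards [hwd.weakDeriv_ae_eq] with x hx
  rw [hx]

/-! ### The potential of the background -/

/-- A negative background charge density of total charge `-z` and finite first moment. -/
structure IsBackground (ρ : ℝ → ℝ) (z : ℝ) : Prop where
  neg : ∀ᵐ x, ρ x < 0
  integrable : Integrable ρ
  moment : Integrable fun x => |x| * |ρ x|
  charge : ∫ x, ρ x = -z

/-- The first absolute moment of a charge density. -/
noncomputable def firstMoment (ρ : ℝ → ℝ) : ℝ := ∫ x, |x| * |ρ x|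

theorem firstMoment_nonneg (ρ : ℝ → ℝ) : 0 ≤ firstMoment ρ :=
  integral_nonneg fun _ => mul_nonneg (abs_nonneg _) (abs_nonneg _)

namespace IsBackground

variable {ρ : ℝ → ℝ} {z : ℝ}

theorem integral_abs (h : IsBackground ρ z) : ∫ x, |ρ x| = z := by
  have : ∫ x, |ρ x| = ∫ x, -ρ x := by
    refine integral_congr_ae ?_
    filter_upwards [h.neg] with x hx
    exact abs_of_neg hx
  rw [this, integral_neg, h.charge, neg_neg]

theorem integrable_abs_sub_mul (h : IsBackground ρ z) (x : ℝ) :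
    Integrable fun y => |x - y| * ρ y := by
  refine Integrable.mono' ((h.integrable.abs.const_mul |x|).add h.moment) ?_
    (Eventually.of_forall fun y => ?_)
  · exact (by fun_prop : Continuous fun y : ℝ => |x - y|).aestronglyMeasurable.mul h.integrable.1
  · rw [Real.norm_eq_abs, abs_mul, abs_abs]
    have := mul_le_mul_of_nonneg_right (abs_sub x y) (abs_nonneg (ρ y))
    simp only [Pi.add_apply]
    linarith

theorem integrable_abs_sub_mul_abs (h : IsBackground ρ z) (x : ℝ) :
    Integrable fun y => |x - y| * |ρ y| := by
  have := (h.integrable_abs_sub_mul x).abs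
  simpa only [abs_mul, abs_abs] using this

theorem potential_eq (h : IsBackground ρ z) (x : ℝ) :
    potential ρ x = 1 / 2 * ∫ y, |x - y| * |ρ y| := by
  have : ∫ y, |x - y| * |ρ y| = ∫ y, -(|x - y| * ρ y) := by
    refine integral_congr_ae ?_
    filter_upwards [h.neg] with y hy
    rw [abs_of_neg hy, mul_neg]
  rw [potential, this, integral_neg]
  ring

theorem potential_le (h : IsBackground ρ z) (x : ℝ) :
    potential ρ x ≤ (z * |x| + firstMoment ρ) / 2 := by
  have h1 : ∫ y, |x - y| * |ρ y| ≤ ∫ y, (|x| * |ρ y| + |y| * |ρ y|) :=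
    integral_mono (h.integrable_abs_sub_mul_abs x)
      ((h.integrable.abs.const_mul |x|).add h.moment) fun y => by
      have := mul_le_mul_of_nonneg_right (abs_sub x y) (abs_nonneg (ρ y))
      simp only
      linarith
  rw [integral_add (h.integrable.abs.const_mul |x|) h.moment, integral_const_mul,
    h.integral_abs] at h1
  rw [h.potential_eq, firstMoment]
  linarith

theorem le_potential (h : IsBackground ρ z) (x : ℝ) :
    (z * |x| - firstMoment ρ) / 2 ≤ potential ρ x := by
  have h1 : ∫ y, (|x| * |ρ y| - |y| * |ρ y|) ≤ ∫ y, |x - y| * |ρ y| :=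
    integral_mono ((h.integrable.abs.const_mul |x|).sub h.moment)
      (h.integrable_abs_sub_mul_abs x) fun y => by
      have := mul_le_mul_of_nonneg_right (abs_sub_abs_le_abs_sub x y) (abs_nonneg (ρ y))
      simp only
      linarith
  rw [integral_sub (h.integrable.abs.const_mul |x|) h.moment, integral_const_mul,
    h.integral_abs] at h1
  rw [h.potential_eq, firstMoment]
  linarith

theorem aestronglyMeasurable_potential (h : IsBackground ρ z) :
    AEStronglyMeasurable (potential ρ) := by
  refine AEStronglyMeasurable.const_mul ?_ _
  refine AEStronglyMeasurable.integral_prod_right'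
    (f := fun p : ℝ × ℝ => |p.1 - p.2| * ρ p.2) ?_
  exact (by fun_prop : Continuous fun p : ℝ × ℝ => |p.1 - p.2|).aestronglyMeasurable.mul
    (h.integrable.1.comp_quasiMeasurePreserving Measure.quasiMeasurePreserving_snd)

end IsBackground

/-- The kernel `V_ρ(x) + V_ρ(y) - |x - y| / 2` of the reduced energy, raised by the first moment of
`ρ`, which makes it dominate `G`. -/
noncomputable def shiftedKernel (ρ : ℝ → ℝ) (p : ℝ × ℝ) : ℝ :=
  potential ρ p.1 + potential ρ p.2 - 1 / 2 * |p.1 - p.2| + firstMoment ρ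

theorem integrable_prod_of_mem_unitMass_X {u : ℝ → ℝ} (hu : u ∈ unitMass X) :
    Integrable fun p : ℝ × ℝ => |p.1| * u p.1 ^ 2 * u p.2 ^ 2 :=
  Integrable.mul_prod (f := fun x => |x| * u x ^ 2) (g := fun x => u x ^ 2) hu.1.2
    hu.1.1.1.integrable_sq

theorem integrable_prod_of_mem_unitMass_X' {u : ℝ → ℝ} (hu : u ∈ unitMass X) :
    Integrable fun p : ℝ × ℝ => |p.2| * u p.1 ^ 2 * u p.2 ^ 2 := by
  have := Integrable.mul_prod (f := fun x => u x ^ 2) (g := fun x => |x| * u x ^ 2)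
    hu.1.1.1.integrable_sq hu.1.2
  exact this.congr (Eventually.of_forall fun p => by simp only; ring)

namespace IsBackground

variable {ρ : ℝ → ℝ} {z : ℝ}

theorem G_add_le_shiftedKernel (h : IsBackground ρ z) (p : ℝ × ℝ) :
    (z - 1) / 2 * (|p.1| + |p.2|) + G p.1 p.2 ≤ shiftedKernel ρ p := by
  have h1 := h.le_potential p.1
  have h2 := h.le_potential p.2
  unfold shiftedKernel G
  linarith

theorem shiftedKernel_le (h : IsBackground ρ z) (p : ℝ × ℝ) :
    shiftedKernel ρ p ≤ (z - 1) / 2 * (|p.1| + |p.2|) + G p.1 p.2 + 2 * firstMoment ρ := by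
  have h1 := h.potential_le p.1
  have h2 := h.potential_le p.2
  unfold shiftedKernel G
  linarith

theorem G_le_shiftedKernel (h : IsBackground ρ z) (hz : 1 ≤ z) (p : ℝ × ℝ) :
    G p.1 p.2 ≤ shiftedKernel ρ p := by
  have h1 := h.G_add_le_shiftedKernel p
  have h2 : 0 ≤ (z - 1) / 2 * (|p.1| + |p.2|) :=
    mul_nonneg (by linarith) (add_nonneg (abs_nonneg _) (abs_nonneg _))
  linarith

theorem aestronglyMeasurable_shiftedKernel_mul (h : IsBackground ρ z) {u : ℝ → ℝ}
    (hu : AEStronglyMeasurable u) :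
    AEStronglyMeasurable fun p : ℝ × ℝ => shiftedKernel ρ p * u p.1 ^ 2 * u p.2 ^ 2 := by
  have hV := h.aestronglyMeasurable_potential
  have hd : AEStronglyMeasurable fun p : ℝ × ℝ => 1 / 2 * |p.1 - p.2| :=
    (by fun_prop : Continuous fun p : ℝ × ℝ => 1 / 2 * |p.1 - p.2|).aestronglyMeasurable
  exact (((((hV.comp_quasiMeasurePreserving Measure.quasiMeasurePreserving_fst).add
    (hV.comp_quasiMeasurePreserving Measure.quasiMeasurePreserving_snd)).sub hd).add
    aestronglyMeasurable_const).mul ((hu.pow 2).comp_quasiMeasurePreserving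
      Measure.quasiMeasurePreserving_fst)).mul ((hu.pow 2).comp_quasiMeasurePreserving
      Measure.quasiMeasurePreserving_snd)

theorem integrable_shiftedKernel_mul_of_le (h : IsBackground ρ z) (hz : 1 ≤ z) {u : ℝ → ℝ}
    (hu : AEStronglyMeasurable u) {k : ℝ × ℝ → ℝ} (hk : ∀ p, shiftedKernel ρ p ≤ k p)
    (hi : Integrable fun p : ℝ × ℝ => k p * u p.1 ^ 2 * u p.2 ^ 2) :
    Integrable fun p : ℝ × ℝ => shiftedKernel ρ p * u p.1 ^ 2 * u p.2 ^ 2 := by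
  refine hi.mono' (h.aestronglyMeasurable_shiftedKernel_mul hu) (Eventually.of_forall fun p => ?_)
  have h0 : 0 ≤ shiftedKernel ρ p := (G_nonneg _ _).trans (h.G_le_shiftedKernel hz p)
  rw [Real.norm_of_nonneg (mul_nonneg (mul_nonneg h0 (sq_nonneg _)) (sq_nonneg _))]
  exact mul_le_mul_of_nonneg_right
    (mul_le_mul_of_nonneg_right (hk p) (sq_nonneg _)) (sq_nonneg _)

theorem unitMass_X_subset (h : IsBackground ρ z) (hz : 1 ≤ z) :
    unitMass X ⊆ admissible (shiftedKernel ρ) := by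
  intro u hu
  have hu2 := hu.1.1.1.integrable_sq
  refine ⟨⟨hu.1.1, hu.2⟩, h.integrable_shiftedKernel_mul_of_le hz hu.1.1.1.1
    (k := fun p => (z - 1) / 2 * (|p.1| + |p.2|) + |p.1| + 2 * firstMoment ρ) (fun p => ?_) ?_⟩
  · linarith [h.shiftedKernel_le p, G_le_abs_left p.1 p.2]
  · have i1 := integrable_prod_of_mem_unitMass_X hu
    have i2 := integrable_prod_of_mem_unitMass_X' hu
    have i3 := (integrable_prod_mul_self hu2).const_mul (2 * firstMoment ρ)
    refine ((((i1.add i2).const_mul ((z - 1) / 2)).add i1).add i3).congr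
      (Eventually.of_forall fun p => ?_)
    simp only [Pi.add_apply]
    ring

/-- An excess of background charge confines: finite energy forces a finite first moment. -/
theorem admissible_eq_unitMass_X (h : IsBackground ρ z) (hz : 1 < z) :
    admissible (shiftedKernel ρ) = unitMass X := by
  refine Subset.antisymm (fun u hu => ?_) (h.unitMass_X_subset hz.le)
  obtain ⟨⟨hH, hm⟩, hi⟩ := hu
  refine ⟨⟨hH, ?_⟩, hm⟩
  have hi' : Integrable fun p : ℝ × ℝ => (|p.1| * u p.1 ^ 2) * u p.2 ^ 2 := by
    refine (hi.const_mul (2 / (z - 1))).mono' ?_ (Eventually.of_forall fun p => ?_)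
    · have hu := hH.1.1
      exact ((by fun_prop : Continuous fun p : ℝ × ℝ => |p.1|).aestronglyMeasurable.mul
        ((hu.pow 2).comp_quasiMeasurePreserving Measure.quasiMeasurePreserving_fst)).mul
        ((hu.pow 2).comp_quasiMeasurePreserving Measure.quasiMeasurePreserving_snd)
    · rw [Real.norm_of_nonneg (mul_nonneg (mul_nonneg (abs_nonneg _) (sq_nonneg _)) (sq_nonneg _)),
        ← mul_assoc, ← mul_assoc]
      refine mul_le_mul_of_nonneg_right
        (mul_le_mul_of_nonneg_right ?_ (sq_nonneg _)) (sq_nonneg _)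
      have hz' : 0 < z - 1 := by linarith
      rw [div_mul_eq_mul_div, le_div_iff₀ hz']
      nlinarith [h.G_add_le_shiftedKernel p, G_nonneg p.1 p.2,
        mul_nonneg hz'.le (abs_nonneg p.2)]
  have h2 := hi'.integral_prod_left
  refine h2.congr (Eventually.of_forall fun x => ?_)
  simp only
  rw [integral_const_mul, hm, mul_one]

/-- For a neutral system `shiftedKernel ρ - G` is bounded, so the two interactions converge
simultaneously. -/
theorem admissible_eq_unitMass_B (h : IsBackground ρ 1) :
    admissible (shiftedKernel ρ) = unitMass B := by
  ext u
  constructor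
  · rintro ⟨⟨hH, hm⟩, hi⟩
    exact ⟨⟨hH, integrable_G_of_le (h.G_le_shiftedKernel le_rfl) hH.1.1 hi⟩, hm⟩
  · rintro ⟨⟨hH, hG⟩, hm⟩
    refine ⟨⟨hH, hm⟩, h.integrable_shiftedKernel_mul_of_le le_rfl hH.1.1
      (k := fun p => G p.1 p.2 + 2 * firstMoment ρ) (fun p => ?_) ?_⟩
    · have := h.shiftedKernel_le p
      linarith
    · refine (hG.add ((integrable_prod_mul_self hH.1.integrable_sq).const_mul
        (2 * firstMoment ρ))).congr (Eventually.of_forall fun p => ?_)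
      simp only [Pi.add_apply]
      ring

end IsBackground

theorem integrable_reducedIntegrand {ρ u : ℝ → ℝ} (hu : u ∈ admissible (shiftedKernel ρ)) :
    Integrable (reducedIntegrand ρ u) := by
  have i := (integrable_prod_mul_self hu.1.1.1.integrable_sq).const_mul (firstMoment ρ)
  refine (hu.2.sub i).congr (Eventually.of_forall fun p => ?_)
  simp only [Pi.sub_apply, reducedIntegrand, shiftedKernel]
  ring

theorem integral_reducedIntegrand {ρ u : ℝ → ℝ} (hu : u ∈ admissible (shiftedKernel ρ)) :
    ∫ p, reducedIntegrand ρ u p =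
      (∫ p : ℝ × ℝ, shiftedKernel ρ p * u p.1 ^ 2 * u p.2 ^ 2) - firstMoment ρ := by
  have i := (integrable_prod_mul_self hu.1.1.1.integrable_sq).const_mul (firstMoment ρ)
  have h1 : ∫ p : ℝ × ℝ, u p.1 ^ 2 * u p.2 ^ 2 = 1 := by
    rw [Measure.volume_eq_prod, integral_prod_mul (fun x => u x ^ 2) (fun x => u x ^ 2), hu.1.2,
      mul_one]
  have h2 : ∫ p : ℝ × ℝ, firstMoment ρ * (u p.1 ^ 2 * u p.2 ^ 2) = firstMoment ρ := by
    rw [integral_const_mul, h1, mul_one]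
  rw [← h2, ← integral_sub hu.2 i]
  refine integral_congr_ae (Eventually.of_forall fun p => ?_)
  simp only [reducedIntegrand, shiftedKernel]
  ring

theorem unitMass_X_nonempty : (unitMass X).Nonempty := by
  let b : ContDiffBump (0 : ℝ) := default
  have hb : ContDiff ℝ ∞ b := b.contDiff
  have hc : HasCompactSupport b := b.hasCompactSupport
  have hpos : 0 < ∫ x, b x ^ 2 := by
    refine Continuous.integral_pos_of_hasCompactSupport_nonneg_nonzero (x := 0)
      (b.continuous.pow 2) ?_ (fun _ => sq_nonneg _) ?_
    · simp only [pow_two]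
      exact hc.mul_left (f := b)
    · have : b 0 = 1 := b.one_of_mem_closedBall (by simp [b.rIn_pos.le])
      simp [this]
  set c := (√(∫ x, b x ^ 2))⁻¹ with hcdef
  have hφ : ContDiff ℝ ∞ fun x => c * b x := contDiff_const.mul hb
  have hcφ : HasCompactSupport fun x => c * b x := hc.mul_left
  refine ⟨fun x => c * b x, ⟨mem_H1_of_contDiff hφ hcφ, ?_⟩, ?_⟩
  · refine Continuous.integrable_of_hasCompactSupport ?_ ?_
    · exact continuous_abs.mul (hφ.continuous.pow 2)
    · simp only [pow_two]
      exact (hcφ.mul_left (f := fun x => c * b x)).mul_left (f := fun x => |x|)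
  · simp only [mul_pow]
    rw [integral_const_mul, hcdef, inv_pow, Real.sq_sqrt hpos.le, inv_mul_cancel₀ hpos.ne']

/-! ### Integrals over growing squares -/

theorem tendsto_setIntegral_zero_of_eventually_notMem {α : Type*} [MeasurableSpace α]
    {μ : Measure α} {F : α → ℝ} (hF : Integrable F μ) {s : ℝ → Set α}
    (hs : ∀ R, MeasurableSet (s R)) (h : ∀ p, ∀ᶠ R in atTop, p ∉ s R) :
    Tendsto (fun R => ∫ p in s R, F p ∂μ) atTop (𝓝 0) := by
  have h1 : Tendsto (fun R => ∫ p, (s R).indicator F p ∂μ) atTop (𝓝 (∫ _, (0 : ℝ) ∂μ)) := by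
    refine tendsto_integral_filter_of_dominated_convergence (fun p => ‖F p‖)
      (Eventually.of_forall fun R => hF.1.indicator (hs R))
      (Eventually.of_forall fun R => Eventually.of_forall fun p => norm_indicator_le_norm_self _ _)
      hF.norm (Eventually.of_forall fun p => ?_)
    refine tendsto_const_nhds.congr' ?_
    filter_upwards [h p] with R hR
    rw [indicator_of_notMem hR]
  rw [integral_zero] at h1
  exact h1.congr fun R => integral_indicator (hs R)

theorem tendsto_setIntegral_of_eventually_mem {α : Type*} [MeasurableSpace α]
    {μ : Measure α} {F : α → ℝ} (hF : Integrable F μ) {s : ℝ → Set α}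
    (hs : ∀ R, MeasurableSet (s R)) (h : ∀ p, ∀ᶠ R in atTop, p ∈ s R) :
    Tendsto (fun R => ∫ p in s R, F p ∂μ) atTop (𝓝 (∫ p, F p ∂μ)) := by
  have h1 := tendsto_setIntegral_zero_of_eventually_notMem hF (fun R => (hs R).compl)
    fun p => (h p).mono fun R hR => not_not.2 hR
  have h2 := h1.const_sub (∫ p, F p ∂μ)
  rw [sub_zero] at h2
  refine h2.congr fun R => ?_
  rw [← integral_add_compl (hs R) hF, add_sub_cancel_right]

theorem eventually_mem_Icc_neg (x : ℝ) : ∀ᶠ R : ℝ in atTop, x ∈ Icc (-R) R :=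
  (eventually_ge_atTop |x|).mono fun _ hR => abs_le.1 hR

theorem measurableSet_square (R : ℝ) : MeasurableSet (Icc (-R) R ×ˢ Icc (-R) R) :=
  measurableSet_Icc.prod measurableSet_Icc

theorem eventually_mem_square (p : ℝ × ℝ) :
    ∀ᶠ R : ℝ in atTop, p ∈ Icc (-R) R ×ˢ Icc (-R) R :=
  ((eventually_mem_Icc_neg p.1).and (eventually_mem_Icc_neg p.2)).mono fun _ h => ⟨h.1, h.2⟩

/-! ### The Coulomb energy of truncated charges -/

theorem integrableOn_square_abs_sub_mul {F H : ℝ → ℝ} (hF : Integrable F) (hH : Integrable H)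
    (R : ℝ) : IntegrableOn (fun p : ℝ × ℝ => |p.1 - p.2| * (F p.1 * H p.2))
      (Icc (-R) R ×ˢ Icc (-R) R) := by
  have hi : Integrable fun p : ℝ × ℝ => F p.1 * H p.2 := hF.mul_prod hH
  refine ((hi.abs.const_mul (2 * R)).integrableOn).mono' ?_ ?_
  · exact ((by fun_prop : Continuous fun p : ℝ × ℝ => |p.1 - p.2|).aestronglyMeasurable.mul
      hi.1).restrict
  · filter_upwards [ae_restrict_mem (measurableSet_square R)] with p hp
    rw [Real.norm_eq_abs, abs_mul, abs_abs]
    refine mul_le_mul_of_nonneg_right ?_ (abs_nonneg _)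
    have h1 := abs_le.2 hp.1
    have h2 := abs_le.2 hp.2
    linarith [abs_sub p.1 p.2]

theorem integrable_abs_sub_mul_prod {F : ℝ → ℝ} (hF : Integrable F)
    (hF' : Integrable fun x => |x| * |F x|) :
    Integrable fun p : ℝ × ℝ => |p.1 - p.2| * (F p.1 * F p.2) := by
  have i1 : Integrable fun p : ℝ × ℝ => (|p.1| * |F p.1|) * |F p.2| := hF'.mul_prod hF.abs
  have i2 : Integrable fun p : ℝ × ℝ => |F p.1| * (|p.2| * |F p.2|) := hF.abs.mul_prod hF'
  refine (i1.add i2).mono' ?_ (Eventually.of_forall fun p => ?_)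
  · exact (by fun_prop : Continuous fun p : ℝ × ℝ => |p.1 - p.2|).aestronglyMeasurable.mul
      (integrable_prod_mul_self hF).1
  · rw [Real.norm_eq_abs, abs_mul, abs_abs, abs_mul]
    have := mul_le_mul_of_nonneg_right (abs_sub p.1 p.2)
      (mul_nonneg (abs_nonneg (F p.1)) (abs_nonneg (F p.2)))
    simp only [Pi.add_apply]
    linarith

theorem integrableOn_abs_mul {f : ℝ → ℝ} (hf : Integrable f) (R : ℝ) :
    IntegrableOn (fun x => |x| * f x) (Icc (-R) R) :=
  hf.integrableOn.continuousOn_mul continuous_abs.continuousOn isCompact_Icc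

theorem integral_square_swap (F H : ℝ → ℝ) (R : ℝ) :
    ∫ p in Icc (-R) R ×ˢ Icc (-R) R, |p.1 - p.2| * (H p.1 * F p.2) =
      ∫ p in Icc (-R) R ×ˢ Icc (-R) R, |p.1 - p.2| * (F p.1 * H p.2) := by
  have := setIntegral_prod_swap (μ := (volume : Measure ℝ)) (ν := (volume : Measure ℝ))
    (Icc (-R) R) (Icc (-R) R) fun p : ℝ × ℝ => |p.1 - p.2| * (F p.1 * H p.2)
  rw [Measure.volume_eq_prod, ← this]
  refine integral_congr_ae (Eventually.of_forall fun p => ?_)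
  simp only [Prod.fst_swap, Prod.snd_swap]
  rw [abs_sub_comm]
  ring

/-- Expansion of the truncated energy into its self-interactions and the cross term. -/
theorem coulombTrunc_eq {ρ u : ℝ → ℝ} (hρ : Integrable ρ) (hu : Integrable fun x => u x ^ 2)
    (R : ℝ) :
    coulombTrunc ρ u R =
      -(1 / 2) * (∫ p in Icc (-R) R ×ˢ Icc (-R) R, |p.1 - p.2| * (u p.1 ^ 2 * u p.2 ^ 2)) -
      (∫ p in Icc (-R) R ×ˢ Icc (-R) R, |p.1 - p.2| * (u p.1 ^ 2 * ρ p.2)) -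
      1 / 2 * ∫ p in Icc (-R) R ×ˢ Icc (-R) R, |p.1 - p.2| * (ρ p.1 * ρ p.2) := by
  have i1 := integrableOn_square_abs_sub_mul hu hu R
  have i2 := integrableOn_square_abs_sub_mul hu hρ R
  have i3 := integrableOn_square_abs_sub_mul hρ hu R
  have i4 := integrableOn_square_abs_sub_mul hρ hρ R
  have e : ∫ p in Icc (-R) R ×ˢ Icc (-R) R, coulombIntegrand ρ u p =
      -((∫ p in Icc (-R) R ×ˢ Icc (-R) R, |p.1 - p.2| * (u p.1 ^ 2 * u p.2 ^ 2)) +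
        (∫ p in Icc (-R) R ×ˢ Icc (-R) R, |p.1 - p.2| * (u p.1 ^ 2 * ρ p.2)) +
        ((∫ p in Icc (-R) R ×ˢ Icc (-R) R, |p.1 - p.2| * (ρ p.1 * u p.2 ^ 2)) +
        ∫ p in Icc (-R) R ×ˢ Icc (-R) R, |p.1 - p.2| * (ρ p.1 * ρ p.2))) := by
    rw [← integral_add i1 i2, ← integral_add i3 i4, ← integral_add (by exact i1.add i2)
      (by exact i3.add i4), ← integral_neg]
    refine integral_congr_ae (Eventually.of_forall fun p => ?_)
    simp only [coulombIntegrand]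
    ring
  rw [coulombTrunc, e, integral_square_swap (fun x => u x ^ 2) ρ]
  ring

namespace IsBackground

variable {ρ : ℝ → ℝ} {z : ℝ}

theorem potential_nonneg (h : IsBackground ρ z) (x : ℝ) : 0 ≤ potential ρ x := by
  rw [h.potential_eq]
  exact mul_nonneg (by norm_num)
    (integral_nonneg fun y => mul_nonneg (abs_nonneg _) (abs_nonneg _))

theorem z_nonneg (h : IsBackground ρ z) : 0 ≤ z := by
  rw [← h.integral_abs]
  exact integral_nonneg fun _ => abs_nonneg _

theorem integrableOn_potential_mul (h : IsBackground ρ z) {f : ℝ → ℝ} (hf : Integrable f)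
    (R : ℝ) : IntegrableOn (fun x => potential ρ x * f x) (Icc (-R) R) := by
  refine ((hf.abs.const_mul ((z * R + firstMoment ρ) / 2)).integrableOn).mono' ?_ ?_
  · exact (h.aestronglyMeasurable_potential.mul hf.1).restrict
  · filter_upwards [ae_restrict_mem measurableSet_Icc] with x hx
    rw [Real.norm_eq_abs, abs_mul, abs_of_nonneg (h.potential_nonneg x)]
    refine mul_le_mul_of_nonneg_right ?_ (abs_nonneg _)
    have := mul_le_mul_of_nonneg_left (abs_le.2 hx) h.z_nonneg
    linarith [h.potential_le x]

theorem setIntegral_reducedIntegrand (h : IsBackground ρ z) {u : ℝ → ℝ}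
    (hu : Integrable fun x => u x ^ 2) (R : ℝ) :
    ∫ p in Icc (-R) R ×ˢ Icc (-R) R, reducedIntegrand ρ u p =
      2 * (∫ x in Icc (-R) R, u x ^ 2) * (∫ x in Icc (-R) R, potential ρ x * u x ^ 2) -
      1 / 2 * ∫ p in Icc (-R) R ×ˢ Icc (-R) R, |p.1 - p.2| * (u p.1 ^ 2 * u p.2 ^ 2) := by
  have hV := h.integrableOn_potential_mul hu R
  have i0 := (integrableOn_square_abs_sub_mul hu hu R).const_mul (1 / 2)
  have i1 : IntegrableOn (fun p : ℝ × ℝ => potential ρ p.1 * u p.1 ^ 2 * u p.2 ^ 2)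
      (Icc (-R) R ×ˢ Icc (-R) R) := by
    rw [IntegrableOn, Measure.volume_eq_prod, ← Measure.prod_restrict]
    exact hV.integrable.mul_prod hu.integrableOn
  have i2 : IntegrableOn (fun p : ℝ × ℝ => u p.1 ^ 2 * (potential ρ p.2 * u p.2 ^ 2))
      (Icc (-R) R ×ˢ Icc (-R) R) := by
    rw [IntegrableOn, Measure.volume_eq_prod, ← Measure.prod_restrict]
    exact hu.integrableOn.integrable.mul_prod hV
  have e1 : ∫ p in Icc (-R) R ×ˢ Icc (-R) R, potential ρ p.1 * u p.1 ^ 2 * u p.2 ^ 2 =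
      (∫ x in Icc (-R) R, potential ρ x * u x ^ 2) * ∫ x in Icc (-R) R, u x ^ 2 :=
    setIntegral_prod_mul (fun x => potential ρ x * u x ^ 2) (fun x => u x ^ 2) _ _
  have e2 : ∫ p in Icc (-R) R ×ˢ Icc (-R) R, u p.1 ^ 2 * (potential ρ p.2 * u p.2 ^ 2) =
      (∫ x in Icc (-R) R, u x ^ 2) * ∫ x in Icc (-R) R, potential ρ x * u x ^ 2 :=
    setIntegral_prod_mul (fun x => u x ^ 2) (fun x => potential ρ x * u x ^ 2) _ _
  have e3 : 2 * (∫ x in Icc (-R) R, u x ^ 2) * (∫ x in Icc (-R) R, potential ρ x * u x ^ 2) =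
      (∫ p in Icc (-R) R ×ˢ Icc (-R) R, potential ρ p.1 * u p.1 ^ 2 * u p.2 ^ 2) +
      ∫ p in Icc (-R) R ×ˢ Icc (-R) R, u p.1 ^ 2 * (potential ρ p.2 * u p.2 ^ 2) := by
    rw [e1, e2]
    ring
  have i12 : IntegrableOn (fun p : ℝ × ℝ => potential ρ p.1 * u p.1 ^ 2 * u p.2 ^ 2 +
      u p.1 ^ 2 * (potential ρ p.2 * u p.2 ^ 2)) (Icc (-R) R ×ˢ Icc (-R) R) := i1.add i2
  rw [e3, ← integral_const_mul, ← integral_add i1 i2, ← integral_sub i12 i0]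
  refine integral_congr_ae (Eventually.of_forall fun p => ?_)
  simp only [reducedIntegrand]
  ring

/-- For `x` in `[-R, R]` the background outside `[-R, R]` contributes to the potential at most
twice its first moment, since `|x - y| ≤ 2 |y|` there. -/
theorem abs_setIntegral_add_potential_le (h : IsBackground ρ z) {R x A : ℝ}
    (hx : x ∈ Icc (-R) R) (hA : A ≤ 1) :
    |(∫ y in Icc (-R) R, |x - y| * ρ y) + 2 * A * potential ρ x| ≤
      2 * (∫ y in (Icc (-R) R)ᶜ, |y| * |ρ y|) + (1 - A) * (z * |x| + firstMoment ρ) := by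
  have hi := h.integrable_abs_sub_mul x
  have h1 := integral_add_compl (measurableSet_Icc (a := -R) (b := R)) hi
  have h2 : |∫ y in (Icc (-R) R)ᶜ, |x - y| * ρ y| ≤ ∫ y in (Icc (-R) R)ᶜ, 2 * (|y| * |ρ y|) := by
    rw [← Real.norm_eq_abs]
    refine norm_integral_le_of_norm_le (h.moment.const_mul 2).integrableOn ?_
    filter_upwards [ae_restrict_mem measurableSet_Icc.compl] with y hy
    rw [Real.norm_eq_abs, abs_mul, abs_abs, ← mul_assoc]
    refine mul_le_mul_of_nonneg_right ?_ (abs_nonneg _)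
    have hy' : R < |y| := by
      by_contra hc
      exact hy (abs_le.1 (not_lt.1 hc))
    linarith [abs_sub x y, abs_le.2 hx]
  rw [integral_const_mul] at h2
  have h3 : ∫ y, |x - y| * ρ y = -2 * potential ρ x := by
    rw [potential]
    ring
  have h4 : (∫ y in Icc (-R) R, |x - y| * ρ y) + 2 * A * potential ρ x =
      -((∫ y in (Icc (-R) R)ᶜ, |x - y| * ρ y) + (1 - A) * (2 * potential ρ x)) := by
    linarith
  rw [h4, abs_neg]
  refine (abs_add_le _ _).trans (add_le_add h2 ?_)
  have hV := h.potential_nonneg x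
  rw [abs_of_nonneg (mul_nonneg (by linarith) (by linarith))]
  refine mul_le_mul_of_nonneg_left ?_ (by linarith)
  linarith [h.potential_le x]

/-- The truncated energy differs from the truncated reduced energy by the missing background and by
the missing mass times the first moment of the mass that is present. -/
theorem abs_coulombTrunc_sub_le (h : IsBackground ρ z) {u : ℝ → ℝ}
    (hu : Integrable fun x => u x ^ 2) (hm : ∫ x, u x ^ 2 = 1) (R : ℝ) :
    |coulombTrunc ρ u R - ((∫ p in Icc (-R) R ×ˢ Icc (-R) R, reducedIntegrand ρ u p) -
        1 / 2 * ∫ p in Icc (-R) R ×ˢ Icc (-R) R, |p.1 - p.2| * (ρ p.1 * ρ p.2))| ≤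
      2 * (∫ y in (Icc (-R) R)ᶜ, |y| * |ρ y|) +
        (1 - ∫ x in Icc (-R) R, u x ^ 2) * firstMoment ρ +
        z * ((1 - ∫ x in Icc (-R) R, u x ^ 2) * ∫ x in Icc (-R) R, |x| * u x ^ 2) := by
  set A := ∫ x in Icc (-R) R, u x ^ 2 with hA
  set τ := ∫ y in (Icc (-R) R)ᶜ, |y| * |ρ y| with hτ
  have hA1 : A ≤ 1 := by
    rw [← hm]
    exact setIntegral_le_integral hu (Eventually.of_forall fun x => sq_nonneg _)
  have hτ0 : 0 ≤ τ := integral_nonneg fun _ => mul_nonneg (abs_nonneg _) (abs_nonneg _)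
  have hV := h.integrableOn_potential_mul hu R
  have i1 := integrableOn_square_abs_sub_mul hu h.integrable R
  have e1 : ∫ p in Icc (-R) R ×ˢ Icc (-R) R, |p.1 - p.2| * (u p.1 ^ 2 * ρ p.2) =
      ∫ x in Icc (-R) R, u x ^ 2 * ∫ y in Icc (-R) R, |x - y| * ρ y := by
    rw [Measure.volume_eq_prod, setIntegral_prod _ i1]
    refine integral_congr_ae (Eventually.of_forall fun x => ?_)
    simp only
    rw [← integral_const_mul]
    refine integral_congr_ae (Eventually.of_forall fun y => ?_)
    simp only
    ring
  have i2 : IntegrableOn (fun x => u x ^ 2 * ∫ y in Icc (-R) R, |x - y| * ρ y)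
      (Icc (-R) R) := by
    rw [IntegrableOn, Measure.volume_eq_prod, ← Measure.prod_restrict] at i1
    refine i1.integral_prod_left.congr (Eventually.of_forall fun x => ?_)
    simp only
    rw [← integral_const_mul]
    refine integral_congr_ae (Eventually.of_forall fun y => ?_)
    simp only
    ring
  have e2 : coulombTrunc ρ u R - ((∫ p in Icc (-R) R ×ˢ Icc (-R) R, reducedIntegrand ρ u p) -
        1 / 2 * ∫ p in Icc (-R) R ×ˢ Icc (-R) R, |p.1 - p.2| * (ρ p.1 * ρ p.2)) =
      -∫ x in Icc (-R) R, (u x ^ 2 * (∫ y in Icc (-R) R, |x - y| * ρ y) +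
        2 * A * (potential ρ x * u x ^ 2)) := by
    rw [integral_add i2 (hV.const_mul _), integral_const_mul, ← e1, coulombTrunc_eq h.integrable hu,
      h.setIntegral_reducedIntegrand hu]
    ring
  rw [e2, abs_neg, ← Real.norm_eq_abs]
  have i3 : IntegrableOn (fun x => (2 * τ + (1 - A) * firstMoment ρ) * u x ^ 2) (Icc (-R) R) :=
    (hu.const_mul _).integrableOn
  have i4 : IntegrableOn (fun x => (1 - A) * z * (|x| * u x ^ 2)) (Icc (-R) R) :=
    (integrableOn_abs_mul hu R).const_mul _
  have i34 : IntegrableOn (fun x => (2 * τ + (1 - A) * firstMoment ρ) * u x ^ 2 +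
      (1 - A) * z * (|x| * u x ^ 2)) (Icc (-R) R) := i3.add i4
  refine (norm_integral_le_of_norm_le i34 ?_).trans ?_
  · filter_upwards [ae_restrict_mem measurableSet_Icc] with x hx
    have := mul_le_mul_of_nonneg_right (h.abs_setIntegral_add_potential_le hx hA1)
      (sq_nonneg (u x))
    have e3 : u x ^ 2 * (∫ y in Icc (-R) R, |x - y| * ρ y) + 2 * A * (potential ρ x * u x ^ 2) =
        ((∫ y in Icc (-R) R, |x - y| * ρ y) + 2 * A * potential ρ x) * u x ^ 2 := by ring
    rw [Real.norm_eq_abs, e3, abs_mul, abs_of_nonneg (sq_nonneg (u x))]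
    linarith
  · rw [integral_add i3 i4, integral_const_mul, integral_const_mul, ← hA]
    have hF := firstMoment_nonneg ρ
    have h5 : 0 ≤ 2 * τ + (1 - A) * firstMoment ρ :=
      add_nonneg (by linarith) (mul_nonneg (by linarith) hF)
    have := mul_le_mul_of_nonneg_left hA1 h5
    linarith

end IsBackground

/-! ### The missing mass times the first moment -/

theorem abs_mul_abs_le_of_nonneg {R x y : ℝ} (hx : x ∈ Icc 0 R) (hy : y ∈ Icc 0 R) :
    |x| * |y| ≤ R * G x y := by
  have h : ∀ a b : ℝ, a ∈ Icc 0 R → b ∈ Icc 0 R → a ≤ b → |a| * |b| ≤ R * G a b := by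
    intro a b ha hb hab
    rw [G, abs_of_nonneg ha.1, abs_of_nonneg hb.1, abs_of_nonpos (by linarith)]
    nlinarith [mul_le_mul_of_nonneg_left hb.2 ha.1]
  rcases le_total x y with hxy | hxy
  · exact h x y hx hy hxy
  · have := h y x hy hx hxy
    rw [G, abs_sub_comm] at this
    rw [G]
    linarith

theorem abs_mul_abs_le_of_nonpos {R x y : ℝ} (hx : x ∈ Ico (-R) 0) (hy : y ∈ Ico (-R) 0) :
    |x| * |y| ≤ R * G x y := by
  have := abs_mul_abs_le_of_nonneg (R := R) (x := -x) (y := -y)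
    ⟨by linarith [hx.2], by linarith [hx.1]⟩ ⟨by linarith [hy.2], by linarith [hy.1]⟩
  have e : G (-x) (-y) = G x y := by
    rw [G, G, abs_neg, abs_neg, neg_sub_neg, abs_sub_comm]
  rwa [abs_neg, abs_neg, e] at this

theorem sq_setIntegral_abs_mul_le {f : ℝ → ℝ} (h0 : ∀ x, 0 ≤ f x)
    (hG : Integrable fun p : ℝ × ℝ => G p.1 p.2 * f p.1 * f p.2) {T : Set ℝ}
    (hT : MeasurableSet T) {R : ℝ} (hR : 0 ≤ R) (hT' : ∀ x ∈ T, ∀ y ∈ T, |x| * |y| ≤ R * G x y)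
    (hi : IntegrableOn (fun x => |x| * f x) T) :
    (∫ x in T, |x| * f x) ^ 2 ≤ R * ∫ p : ℝ × ℝ, G p.1 p.2 * f p.1 * f p.2 := by
  have hi2 : IntegrableOn (fun p : ℝ × ℝ => (|p.1| * f p.1) * (|p.2| * f p.2)) (T ×ˢ T) := by
    rw [IntegrableOn, Measure.volume_eq_prod, ← Measure.prod_restrict]
    exact hi.integrable.mul_prod hi
  have e : (∫ x in T, |x| * f x) ^ 2 =
      ∫ p in T ×ˢ T, (|p.1| * f p.1) * (|p.2| * f p.2) := by
    rw [pow_two]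
    exact (setIntegral_prod_mul (fun x => |x| * f x) (fun x => |x| * f x) T T).symm
  have h1 : ∫ p in T ×ˢ T, (|p.1| * f p.1) * (|p.2| * f p.2) ≤
      ∫ p in T ×ˢ T, R * (G p.1 p.2 * f p.1 * f p.2) := by
    refine setIntegral_mono_on hi2 (hG.const_mul R).integrableOn (hT.prod hT) fun p hp => ?_
    have := mul_le_mul_of_nonneg_right (hT' _ hp.1 _ hp.2) (mul_nonneg (h0 p.1) (h0 p.2))
    linarith
  have h2 : ∫ p in T ×ˢ T, G p.1 p.2 * f p.1 * f p.2 ≤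
      ∫ p : ℝ × ℝ, G p.1 p.2 * f p.1 * f p.2 :=
    setIntegral_le_integral hG (Eventually.of_forall fun p =>
      mul_nonneg (mul_nonneg (G_nonneg _ _) (h0 _)) (h0 _))
  rw [integral_const_mul] at h1
  rw [e]
  exact h1.trans (mul_le_mul_of_nonneg_left h2 hR)

/-- On either half-line `|x| |y| ≤ R G(x, y)` within `[-R, R]`, so the truncated first moment is
at most of order `√R`. -/
theorem setIntegral_abs_mul_le {f : ℝ → ℝ} (h0 : ∀ x, 0 ≤ f x) (hf : Integrable f)
    (hG : Integrable fun p : ℝ × ℝ => G p.1 p.2 * f p.1 * f p.2) {R : ℝ} (hR : 0 ≤ R) :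
    ∫ x in Icc (-R) R, |x| * f x ≤ 2 * √(R * ∫ p : ℝ × ℝ, G p.1 p.2 * f p.1 * f p.2) := by
  have hi := integrableOn_abs_mul hf R
  have hu : Icc (-R) R = Ico (-R) 0 ∪ Icc 0 R :=
    (Ico_union_Icc_eq_Icc (by linarith) hR).symm
  have hd : Disjoint (Ico (-R) 0) (Icc 0 R) := by
    rw [Set.disjoint_left]
    intro x hx hx'
    exact absurd hx.2 (not_lt.2 hx'.1)
  have i1 := hi.mono_set (hu ▸ subset_union_left : Ico (-R) 0 ⊆ Icc (-R) R)
  have i2 := hi.mono_set (hu ▸ subset_union_right : Icc 0 R ⊆ Icc (-R) R)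
  have h1 := Real.le_sqrt_of_sq_le (sq_setIntegral_abs_mul_le h0 hG measurableSet_Ico hR
    (fun x hx y hy => abs_mul_abs_le_of_nonpos hx hy) i1)
  have h2 := Real.le_sqrt_of_sq_le (sq_setIntegral_abs_mul_le h0 hG measurableSet_Icc hR
    (fun x hx y hy => abs_mul_abs_le_of_nonneg hx hy) i2)
  rw [hu, setIntegral_union hd measurableSet_Icc i1 i2]
  linarith

/-- A tail of mass `o(R^{-1/2})` times a truncated first moment of order `R^{1/2}`. -/
theorem tendsto_tail_mul_moment {f : ℝ → ℝ} (h0 : ∀ x, 0 ≤ f x) (hf : Integrable f)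
    (hG : Integrable fun p : ℝ × ℝ => G p.1 p.2 * f p.1 * f p.2) {S : ℝ → Set ℝ}
    (hS : ∀ R, MeasurableSet (S R)) (hSG : ∀ R, 0 ≤ R → ∀ x ∈ S R, ∀ y ∈ S R, R ≤ G x y)
    (hS' : ∀ x, ∀ᶠ R in atTop, x ∉ S R) :
    Tendsto (fun R => (∫ x in S R, f x) * ∫ x in Icc (-R) R, |x| * f x) atTop (𝓝 0) := by
  set C := ∫ p : ℝ × ℝ, G p.1 p.2 * f p.1 * f p.2 with hC
  have hC0 : 0 ≤ C := integral_nonneg fun p =>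
    mul_nonneg (mul_nonneg (G_nonneg _ _) (h0 _)) (h0 _)
  have hd : Tendsto (fun R => ∫ p in S R ×ˢ S R, G p.1 p.2 * f p.1 * f p.2) atTop (𝓝 0) :=
    tendsto_setIntegral_zero_of_eventually_notMem hG (fun R => (hS R).prod (hS R))
      fun p => (hS' p.1).mono fun R hR h => hR h.1
  have hlim : Tendsto (fun R => 2 * √((∫ p in S R ×ˢ S R, G p.1 p.2 * f p.1 * f p.2) * C))
      atTop (𝓝 0) := by
    have := ((Real.continuous_sqrt.tendsto _).comp (hd.mul_const C)).const_mul 2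
    simpa using this
  refine squeeze_zero' (Eventually.of_forall fun R => mul_nonneg (integral_nonneg h0)
    (integral_nonneg fun x => mul_nonneg (abs_nonneg _) (h0 x))) ?_ hlim
  filter_upwards [eventually_gt_atTop 0] with R hR
  have h1 := mul_sq_setIntegral_le h0 hf hG (hS R) (hSG R hR.le)
  have h2 := setIntegral_abs_mul_le h0 hf hG hR.le
  have h3 : 0 ≤ ∫ x in S R, f x := integral_nonneg h0
  refine (mul_le_mul_of_nonneg_left h2 h3).trans ?_
  rw [mul_left_comm]
  refine mul_le_mul_of_nonneg_left ?_ (by norm_num)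
  refine Real.le_sqrt_of_sq_le ?_
  rw [mul_pow, Real.sq_sqrt (mul_nonneg hR.le hC0), mul_comm R]
  have := mul_le_mul_of_nonneg_right h1 hC0
  linarith

theorem tendsto_one_sub_mul_moment {f : ℝ → ℝ} (h0 : ∀ x, 0 ≤ f x) (hf : Integrable f)
    (hm : ∫ x, f x = 1)
    (hG : Integrable fun p : ℝ × ℝ => G p.1 p.2 * f p.1 * f p.2) :
    Tendsto (fun R => (1 - ∫ x in Icc (-R) R, f x) * ∫ x in Icc (-R) R, |x| * f x)
      atTop (𝓝 0) := by
  have h1 := tendsto_tail_mul_moment h0 hf hG (S := fun R => Ioi R) (fun R => measurableSet_Ioi)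
    (fun R hR x hx y hy => le_G_of_lt hR hx hy)
    fun x => (eventually_ge_atTop x).mono fun R hR => not_lt.2 hR
  have h2 := tendsto_tail_mul_moment h0 hf hG (S := fun R => Iio (-R))
    (fun R => measurableSet_Iio) (fun R hR x hx y hy => le_G_of_lt_neg hR hx hy)
    fun x => (eventually_ge_atTop (-x)).mono fun R hR => by
      rw [mem_Iio, not_lt]
      linarith
  have h3 := h1.add h2
  rw [add_zero] at h3
  refine h3.congr' ?_
  filter_upwards [eventually_ge_atTop 0] with R hR
  rw [← hm, integral_eq_add_tails hf hR]
  ring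

/-! ### The energy on the admissible class -/

theorem IsBackground.tendsto_coulombTrunc {ρ u : ℝ → ℝ} {z : ℝ} (h : IsBackground ρ z)
    (hz : 1 ≤ z) (hu : u ∈ admissible (shiftedKernel ρ)) :
    Tendsto (coulombTrunc ρ u) atTop (𝓝 (reducedCoulomb ρ u)) := by
  have hu2 := hu.1.1.1.integrable_sq
  have hG := integrable_G_of_le (h.G_le_shiftedKernel hz) hu.1.1.1.1 hu.2
  have hA : Tendsto (fun R => ∫ x in Icc (-R) R, u x ^ 2) atTop (𝓝 1) := by
    have := tendsto_setIntegral_of_eventually_mem hu2 (s := fun R => Icc (-R) R)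
      (fun R => measurableSet_Icc) eventually_mem_Icc_neg
    rwa [hu.1.2] at this
  have hτ : Tendsto (fun R => ∫ y in (Icc (-R) R)ᶜ, |y| * |ρ y|) atTop (𝓝 0) :=
    tendsto_setIntegral_zero_of_eventually_notMem h.moment (fun R => measurableSet_Icc.compl)
      fun x => (eventually_mem_Icc_neg x).mono fun R hR => not_not.2 hR
  have herr := ((hτ.const_mul 2).add ((hA.const_sub 1).mul_const (firstMoment ρ))).add
    ((tendsto_one_sub_mul_moment (fun x => sq_nonneg (u x)) hu2 hu.1.2 hG).const_mul z)
  simp only [mul_zero, sub_self, zero_mul, add_zero] at herr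
  have hmain := (tendsto_setIntegral_of_eventually_mem (integrable_reducedIntegrand hu)
    measurableSet_square eventually_mem_square).sub
    ((tendsto_setIntegral_of_eventually_mem (integrable_abs_sub_mul_prod h.integrable h.moment)
      measurableSet_square eventually_mem_square).const_mul (1 / 2))
  have hdiff := squeeze_zero_norm (fun R => (Real.norm_eq_abs _).trans_le <|
    h.abs_coulombTrunc_sub_le hu2 hu.1.2 R) herr
  have hsum := hdiff.add hmain
  have e : reducedCoulomb ρ u = (∫ p, reducedIntegrand ρ u p) -
      1 / 2 * ∫ p : ℝ × ℝ, |p.1 - p.2| * (ρ p.1 * ρ p.2) := by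
    have e1 : ∫ p : ℝ × ℝ, -|p.1 - p.2| * ρ p.1 * ρ p.2 =
        -∫ p : ℝ × ℝ, |p.1 - p.2| * (ρ p.1 * ρ p.2) := by
      rw [← integral_neg]
      refine integral_congr_ae (Eventually.of_forall fun p => ?_)
      simp only
      ring
    rw [reducedCoulomb, e1]
    ring
  rw [e]
  rw [zero_add] at hsum
  exact hsum.congr fun R => sub_add_cancel _ _

/-- On the admissible class the energy is the functional with kernel `shiftedKernel ρ`, up to an
additive constant. -/
theorem IsBackground.energy_eq {ρ u : ℝ → ℝ} {z : ℝ} (h : IsBackground ρ z)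
    (hz : 1 ≤ z) (hu : u ∈ admissible (shiftedKernel ρ)) :
    energy ρ u = functional (shiftedKernel ρ) u +
      (1 / 2 * (∫ p : ℝ × ℝ, -|p.1 - p.2| * ρ p.1 * ρ p.2) - firstMoment ρ) := by
  rw [energy, (h.tendsto_coulombTrunc hz hu).limUnder_eq, reducedCoulomb,
    integral_reducedIntegrand hu, functional]
  ring

theorem integrable_coulombIntegrand {ρ u : ℝ → ℝ} {z : ℝ} (h : IsBackground ρ z)
    (hu : u ∈ unitMass X) : Integrable (coulombIntegrand ρ u) := by
  have hu2 := hu.1.1.1.integrable_sq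
  have hF : Integrable fun x => u x ^ 2 + ρ x := hu2.add h.integrable
  have hF' : Integrable fun x => |x| * |u x ^ 2 + ρ x| := by
    refine (hu.1.2.add h.moment).mono' ?_ (Eventually.of_forall fun x => ?_)
    · exact continuous_abs.aestronglyMeasurable.mul hF.abs.1
    · rw [Real.norm_of_nonneg (mul_nonneg (abs_nonneg _) (abs_nonneg _))]
      have h1 := abs_add_le (u x ^ 2) (ρ x)
      rw [abs_of_nonneg (sq_nonneg (u x))] at h1
      have := mul_le_mul_of_nonneg_left h1 (abs_nonneg x)
      simp only [Pi.add_apply]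
      linarith
  refine (integrable_abs_sub_mul_prod hF hF').neg.congr (Eventually.of_forall fun p => ?_)
  simp only [coulombIntegrand, Pi.neg_apply]
  ring

theorem energy_eq_of_integrable {ρ u : ℝ → ℝ} (hi : Integrable (coulombIntegrand ρ u)) :
    energy ρ u = (∫ x, weakDeriv u x ^ 2) + 1 / 2 * ∫ p, coulombIntegrand ρ u p := by
  have : Tendsto (coulombTrunc ρ u) atTop (𝓝 (1 / 2 * ∫ p, coulombIntegrand ρ u p)) :=
    (tendsto_setIntegral_of_eventually_mem hi measurableSet_square
      eventually_mem_square).const_mul (1 / 2)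
  rw [energy, this.limUnder_eq]

theorem IsBackground.exists_isGLB {ρ : ℝ → ℝ} {z : ℝ} (h : IsBackground ρ z) (hz : 1 ≤ z) :
    ∃ u ∈ admissible (shiftedKernel ρ),
      IsGLB (energy ρ '' admissible (shiftedKernel ρ)) (energy ρ u) := by
  obtain ⟨u, hu, hmin⟩ := exists_minimizer (h.G_le_shiftedKernel hz)
    (unitMass_X_nonempty.mono (h.unitMass_X_subset hz))
  refine ⟨u, hu, IsLeast.isGLB ⟨mem_image_of_mem _ hu, ?_⟩⟩
  rintro _ ⟨v, hv, rfl⟩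
  rw [h.energy_eq hz hu, h.energy_eq hz hv]
  have := hmin v hv
  linarith

end MaxwellSchrodinger

theorem mainTheorem3 (ρ : ℝ → ℝ) (z : ℝ)
    (hneg : ∀ᵐ x, ρ x < 0)
    (hint : Integrable ρ)
    (hmoment : Integrable (fun x => |x| * |ρ x|))
    (hcharge : ∫ x, ρ x = -z)
    (hz : 1 ≤ z) :
    -- on `𝓧₁` the double integral in the energy is an absolutely convergent one
    (∀ v ∈ MaxwellSchrodinger.unitMass MaxwellSchrodinger.X,
      Integrable (MaxwellSchrodinger.coulombIntegrand ρ v) ∧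
      MaxwellSchrodinger.energy ρ v =
        (∫ x, MaxwellSchrodinger.weakDeriv v x ^ 2) +
          1 / 2 * ∫ p, MaxwellSchrodinger.coulombIntegrand ρ v p) ∧
    -- the case `z > 1`
    (1 < z →
      ∃ u ∈ MaxwellSchrodinger.unitMass MaxwellSchrodinger.X,
        IsGLB (MaxwellSchrodinger.energy ρ ''
            MaxwellSchrodinger.unitMass MaxwellSchrodinger.X)
          (MaxwellSchrodinger.energy ρ u)) ∧
    -- the case `z = 1`: the energy is well defined on `𝓑₁`, and its infimum is attained
    (z = 1 →
      (∀ v ∈ MaxwellSchrodinger.unitMass MaxwellSchrodinger.B,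
        Integrable (MaxwellSchrodinger.reducedIntegrand ρ v) ∧
        Tendsto (MaxwellSchrodinger.coulombTrunc ρ v) atTop
          (𝓝 (MaxwellSchrodinger.reducedCoulomb ρ v))) ∧
      ∃ u ∈ MaxwellSchrodinger.unitMass MaxwellSchrodinger.B,
        IsGLB (MaxwellSchrodinger.energy ρ ''
            MaxwellSchrodinger.unitMass MaxwellSchrodinger.B)
          (MaxwellSchrodinger.energy ρ u)) := by
  have h : MaxwellSchrodinger.IsBackground ρ z := ⟨hneg, hint, hmoment, hcharge⟩
  refine ⟨fun v hv => ?_, fun hz1 => ?_, fun hz1 => ?_⟩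
  · have hi := MaxwellSchrodinger.integrable_coulombIntegrand h hv
    exact ⟨hi, MaxwellSchrodinger.energy_eq_of_integrable hi⟩
  · have := h.exists_isGLB hz
    rwa [h.admissible_eq_unitMass_X hz1] at this
  · subst hz1
    have := h.exists_isGLB le_rfl
    rw [h.admissible_eq_unitMass_B] at this
    refine ⟨fun v hv => ?_, this⟩
    rw [← h.admissible_eq_unitMass_B] at hv
    exact ⟨MaxwellSchrodinger.integrable_reducedIntegrand hv, h.tendsto_coulombTrunc le_rfl hv⟩
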